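/- Let $\Gamma$ be a finite directed multigraph (multiple edges and self-loops allowed, not necessarily connected) with vertices $v_1,\dots,v_{n+1}$ and edges $e_1,\dots,e_m$, both with arbitrary labelling and arbitrary edge directions. Write $v_\star=v_{n+1}$, let $L_\Gamma=m-n$ be its loop number, and call $\Gamma$ a tree if it is connected and $L_\Gamma=0$. The graph $\Gamma$ is 1PI if it is connected and stays connected after the deletion of any single edge. *Dodgson polynomials and $Q_E$.* Let $\mathbb I$ be the reduced incidence matrix, with rows indexed by edges and columns by vertices other than $v_\star$: the row of an edge $u\to w$ is $-1$ at $u$ and $+1$ at $w$ (the row of a self-loop is $0$). Let $\mathbb D=\operatorname{diag}(a_1,\dots,a_m)$ and $\mathbb M=\begin{pmatrix}\mathbb D&\mathbb I\\-\mathbb I^T&0\end{pmatrix}$. For edges $i,j$, let $\psi^{i,j}\in\mathbb R[a_1,\dots,a_m]$ be the determinant of $\mathbb M$ with row $i$ and column $j$ removed. For an integer $L$ and a set $E$ of $2L$ edges put $$Q_E=\sum_{E=E_1\sqcup E_2}\operatorname{sgn}(E_1\oplus E_2)\Big(\sum_{\mu}\operatorname{sgn}(\mu)\prod_{(p_1,p_2)\in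 \mu}\psi^{p_1,p_2}\Big)\prod_{r=1}^{2}\Big(\sum_{\sigma}\psi^{\sigma(e^{r}_1),\sigma(e^{r}_2)}\cdots\psi^{\sigma(e^{r}_{L-1}),\sigma(e^{r}_{L})}\Big).$$ Here the sum runs over all ordered partitions of $E$ into two sets $E_r=\{e^r_1<\dots<e^r_L\}$ of $L$ edges each; $\operatorname{sgn}(E_1\oplus E_2)$ is the sign of the permutation that sorts the word $e^1_1\cdots e^1_Le^2_1\cdots e^2_L$; $\mu$ runs over the $L!$ matchings of $E_1$ with $E_2$, and $\operatorname{sgn}(\mu)$ is the sign of the corresponding permutation of $\{1,\dots,L\}$; and $\sigma$ runs over all permutations of $E_r$. *The form $\alpha_\Gamma$.* For $a\in(0,\infty)^m$ and positions $x\in\mathbb R^{n}$ of the vertices other than $v_\star$ (with $x_{v_\star}=0$), let $s_e=(x_e^+-x_e^-)/\sqrt{a_e}$, where $x_e^{-}$ and $x_e^+$ are the positions of the start and the end vertex of $e$. Expand the form $\bigwedge_{e}e^{-s_e^2}\,ds_e$ (edges in increasing order) in the variables $(a,x)$, and let $f_S(a,x)$ be the coefficient of $\big(\bigwedge_{e\in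 S}da_e\big)\wedge dx_1\wedge\dots\wedge dx_n$ in it. Then $$\alpha_\Gamma=\int_{\mathbb R^{n}}\bigwedge_e e^{-s_e^2}ds_e:=\sum_{S}\Big(\int_{\mathbb R^{n}}f_S(a,x)\,dx\Big)\bigwedge_{e\in S}da_e ,$$ where $S$ runs over all sets of edges and the $da_e$ are in increasing order. Let $\bar Q_E(a)$ be the coefficient of $\bigwedge_{e\in E}da_e$ in $\alpha_\Gamma\wedge\alpha_\Gamma$. **Theorem.** 1. If $\Gamma$ is 1PI with even loop number $L=L_\Gamma>0$, then for every set $E$ of exactly $2L$ edges, $Q_E=0$ as a polynomial in $a_1,\dots,a_m$, and $\bar Q_E(a)=0$ for all $a\in(0,\infty)^m$. 2. For every $\Gamma$, all the integrals $\int_{\mathbb R^n} f_S(a,x)\,dx$ that define $\alpha_\Gamma$ converge absolutely, for all $a\in(0,\infty)^m$. 3. If $\Gamma$ is not a tree, then $\alpha_\Gamma\wedge\alpha_\Gamma=0$ on $(0,\infty)^m$. -/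

import Mathlib

open MeasureTheory Module

noncomputable section

/-- A finite directed multigraph with vertices `v_1, …, v_{n+1}` (indexed by `Fin (n + 1)`) and edges
`e_1, …, e_m` (indexed by `Fin m`).  Multiple edges and self-loops are allowed, and the graph need not
be connected.  The edge `e` runs from `src e` to `tgt e`.  The last vertex is the special vertex `v_⋆`,
whose position is fixed to `0`. -/
structure FeynmanGraph (n m : ℕ) where
  src : Fin m → Fin (n + 1)
  tgt : Fin m → Fin (n + 1)

namespace FeynmanGraph

variable {n m : ℕ} (Γ : FeynmanGraph n m)

/-- The simple graph on all the vertices of `Γ` that joins two distinct vertices when they are the two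
ends of some edge in `S`. -/
def toSimpleGraph (S : Set (Fin m)) : SimpleGraph (Fin (n + 1)) :=
  SimpleGraph.fromRel fun u v => ∃ e ∈ S, Γ.src e = u ∧ Γ.tgt e = v

/-- `Γ` is connected. -/
def IsConnected : Prop := (Γ.toSimpleGraph Set.univ).Connected

/-- One-particle irreducible: `Γ` is connected and stays connected after deleting any single edge. -/
def IsOnePI : Prop := Γ.IsConnected ∧ ∀ e : Fin m, (Γ.toSimpleGraph {e}ᶜ).Connected

/-- The loop number `|E_Γ| - (|V_Γ| - 1)`. -/
def loopNumber (_Γ : FeynmanGraph n m) : ℤ := (m : ℤ) - n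

/-- A tree is a connected graph of loop number `0`. -/
def IsTree : Prop := Γ.IsConnected ∧ Γ.loopNumber = 0

/-! ### The differential form `α_Γ` -/

/-- The space of pairs `(a, x)` of Schwinger parameters and positions of the vertices other than
`v_⋆`. -/
abbrev TotalSpace (n m : ℕ) : Type := (Fin m → ℝ) × (Fin n → ℝ)

/-- The positions of all vertices; that of `v_⋆` is `0`. -/
def position (x : Fin n → ℝ) : Fin (n + 1) → ℝ := Fin.snoc (α := fun _ => ℝ) x 0

/-- The edge variable `s_e = (x_e^+ - x_e^-) / √a_e`, as a function of `(a, x)`. -/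
def edgeVar (e : Fin m) (p : TotalSpace n m) : ℝ :=
  (position p.2 (Γ.tgt e) - position p.2 (Γ.src e)) / √(p.1 e)

/-- The differential `ds_e` at the point `p = (a, x)`. -/
def dEdgeVar (e : Fin m) (p : TotalSpace n m) : Dual ℝ (TotalSpace n m) :=
  (fderiv ℝ (Γ.edgeVar e) p).toLinearMap

/-- The value at `p = (a, x)` of the differential form `⋀_e e^{-s_e²} ds_e`, the edges being taken in
increasing order. -/
def integrand (p : TotalSpace n m) : ExteriorAlgebra ℝ (Dual ℝ (TotalSpace n m)) :=
  ExteriorAlgebra.ιMulti ℝ m fun e => Real.exp (-(Γ.edgeVar e p) ^ 2) • Γ.dEdgeVar e p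

/-- The coordinate 1-forms `da_1, …, da_m, dx_1, …, dx_n` on the total space, in this order. -/
def coordForms (n m : ℕ) : Basis (Fin (m + n)) ℝ (Dual ℝ (TotalSpace n m)) :=
  (((Pi.basisFun ℝ (Fin m)).prod (Pi.basisFun ℝ (Fin n))).reindex finSumFinEquiv).dualBasis

/-- The basis of the forms at a point of the space of Schwinger parameters that consists of the
products `da_{i_1} ∧ ⋯ ∧ da_{i_k}` with `i_1 < ⋯ < i_k`. -/
def edgeForms (m : ℕ) : Basis (Finset (Fin m)) ℝ (ExteriorAlgebra ℝ (Dual ℝ (Fin m → ℝ))) :=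
  (Pi.basisFun ℝ (Fin m)).dualBasis.ExteriorAlgebra

/-- The index set of the basis form `(⋀_{e ∈ S} da_e) ∧ dx_1 ∧ ⋯ ∧ dx_n`. -/
def withAllPositions (n : ℕ) {m : ℕ} (S : Finset (Fin m)) : Finset (Fin (m + n)) :=
  S.map (Fin.castAddEmb n) ∪ Finset.univ.map (Fin.natAddEmb m)

/-- The coefficient function of `(⋀_{e ∈ S} da_e) ∧ dx_1 ∧ ⋯ ∧ dx_n` in `⋀_e e^{-s_e²} ds_e`, at the
Schwinger parameters `a`. -/
def fiberCoeff (a : Fin m → ℝ) (S : Finset (Fin m)) (x : Fin n → ℝ) : ℝ :=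
  (coordForms n m).ExteriorAlgebra.repr (Γ.integrand (a, x)) (withAllPositions n S)

/-- The value at `a` of the differential form `α_Γ = ∫_{ℝ^n} ⋀_e e^{-s_e²} ds_e`.  As usual for the
integral of a form over the fibre, only the terms that contain all of `dx_1, …, dx_n` contribute, and
their coefficients are integrated over `x ∈ ℝ^n`. -/
def alpha (a : Fin m → ℝ) : ExteriorAlgebra ℝ (Dual ℝ (Fin m → ℝ)) :=
  ∑ S : Finset (Fin m), (∫ x : Fin n → ℝ, Γ.fiberCoeff a S x) • edgeForms m S

/-! ### Dodgson polynomials -/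

/-- The reduced incidence matrix: the column of `v_⋆` is left out.  The row of a self-loop is zero. -/
def incidence : Matrix (Fin m) (Fin n) ℤ := fun e v =>
  (if Γ.tgt e = v.castSucc then 1 else 0) - (if Γ.src e = v.castSucc then 1 else 0)

/-- The expanded Laplacian `(D, I; -Iᵀ, 0)`, where `D = diag(a_1, …, a_m)`; its entries are polynomials in
the Schwinger parameters. -/
def expandedLaplacian : Matrix (Fin (m + n)) (Fin (m + n)) (MvPolynomial (Fin m) ℝ) :=
  (Matrix.fromBlocks (Matrix.diagonal MvPolynomial.X) (Γ.incidence.map Int.cast)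
    (-(Γ.incidence.map Int.cast).transpose) 0).reindex finSumFinEquiv finSumFinEquiv

/-- The Dodgson polynomial `ψ^{A,B}`: the determinant of the expanded Laplacian with the rows `A` and the
columns `B` removed, the others being kept in increasing order. -/
def dodgson (A B : Finset (Fin (m + n))) (h : A.card = B.card) : MvPolynomial (Fin m) ℝ :=
  (Γ.expandedLaplacian.submatrix
    (Aᶜ.orderEmbOfFin (k := m + n - A.card) (by simp [Finset.card_compl]))
    (Bᶜ.orderEmbOfFin (k := m + n - A.card) (by simp [Finset.card_compl, h]))).det

/-- The edge-indexed Dodgson polynomial `ψ^{i,j}`. -/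
def edgeDodgson (i j : Fin m) : MvPolynomial (Fin m) ℝ :=
  Γ.dodgson {Fin.castAdd n i} {Fin.castAdd n j} (by simp)

/-! ### The sum `Q_E` -/

/-- The permutation sign of a word with distinct letters: `-1` to the number of its inversions. -/
def wordSign {k : ℕ} (w : Fin k → Fin m) : ℤ :=
  (-1) ^ (Finset.univ.filter fun p : Fin k × Fin k => p.1 < p.2 ∧ w p.2 < w p.1).card

/-- For words `w = e_1 ⋯ e_L` and `w' = e'_1 ⋯ e'_L`, the sum over all the `L!` matchings of their letters,
with sign, of the products of the `ψ^{p_1,p_2}` over the matched pairs `(p_1, p_2)`. -/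
def matchingSum {L : ℕ} (w w' : Fin L → Fin m) : MvPolynomial (Fin m) ℝ :=
  ∑ τ : Equiv.Perm (Fin L),
    ((Equiv.Perm.sign τ : ℤ) : MvPolynomial (Fin m) ℝ) * ∏ i, Γ.edgeDodgson (w i) (w' (τ i))

/-- For a word `w = e_1 ⋯ e_L` of even length, the sum over all permutations `σ` of its letters of
`ψ^{σ(e_1),σ(e_2)} ψ^{σ(e_3),σ(e_4)} ⋯ ψ^{σ(e_{L-1}),σ(e_L)}`. -/
def pairingSum {L : ℕ} (w : Fin L → Fin m) : MvPolynomial (Fin m) ℝ :=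
  ∑ σ : Equiv.Perm (Fin L), ∏ k : Fin (L / 2),
    Γ.edgeDodgson (w (σ ⟨2 * k, by omega⟩)) (w (σ ⟨2 * k + 1, by omega⟩))

/-- The ordered partitions `E = E_1 ∪ E_2` of `E` into two disjoint sets of `L` edges each. -/
abbrev Halving (L : ℕ) (E : Finset (Fin m)) : Type :=
  {p : Finset (Fin m) × Finset (Fin m) //
    Disjoint p.1 p.2 ∧ p.1 ∪ p.2 = E ∧ p.1.card = L ∧ p.2.card = L}

/-- The edges of `E_1` in increasing order. -/
def Halving.fst {L : ℕ} {E : Finset (Fin m)} (p : Halving L E) : Fin L → Fin m :=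
  p.1.1.orderEmbOfFin p.2.2.2.1

/-- The edges of `E_2` in increasing order. -/
def Halving.snd {L : ℕ} {E : Finset (Fin m)} (p : Halving L E) : Fin L → Fin m :=
  p.1.2.orderEmbOfFin p.2.2.2.2

/-- The polynomial `Q_E`: the sum over `E = E_1 ∪ E_2` of `sgn(E_1 ⊕ E_2)` times the signed sum over the
matchings of `E_1` with `E_2`, times the sums over the permutations of `E_1` and of `E_2`. -/
def Q (L : ℕ) (E : Finset (Fin m)) : MvPolynomial (Fin m) ℝ :=
  ∑ p : Halving L E,
    (wordSign (Fin.append p.fst p.snd) : MvPolynomial (Fin m) ℝ) *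
      Γ.matchingSum p.fst p.snd * Γ.pairingSum p.fst * Γ.pairingSum p.snd

/-- The coefficient `Q̄_E` of `dE = ⋀_{e ∈ E} da_e` in `α_Γ ∧ α_Γ`, at the Schwinger parameters `a`. -/
def barQ (E : Finset (Fin m)) (a : Fin m → ℝ) : ℝ :=
  (edgeForms m).repr (Γ.alpha a * Γ.alpha a) E

end FeynmanGraph

end

/-! Vanishing of α∧α. Write x_e for the position difference along e and I for the incidence matrix.
Up to the factor a_e^{-1/2}, ds_e is dx_e - x_e/(2a_e) da_e. Extracting dx_1∧…∧dx_n amounts to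
contracting ⋀ da_e with the columns of I. This gives a constant form W = `cycleForm` of degree L = m
- n, in which each da_e then picks up a factor x_e (`fiberCoeff_eq`). So α is, up to a scalar and a
diagonal rescaling, the Gaussian integral A of W with da_e replaced by x_e da_e (`alpha_eq`). If I
has a kernel, W = 0. Otherwise Γ is connected, the weight is a nondegenerate Gaussian, and L ≠ 0
unless Γ is a tree.

If L is odd, A is odd and A² = 0. If L is even, A is central, so contracting A² with e gives
2A·∂_eA. As A² has no constant term, it suffices that A·∂_eA = 0 (`gaussForm_mul_contractRight`).
Let G(Z) and G_f(Z) be the Gaussian integrals of Z without and with an extra factor x_f; then A =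
G(W) and ∂_eA = G_e(∂_eW). Two identities enter: (a) Σ_v I_{fv} U_v = δ_{fe} W - ∂_eW∧da_f for
suitable U_v, because W is a contraction of the top form; (b) Σ_f (2/a_f) I_{fv} G_f(∂_eW) = Σ_f
I_{fv} G(∂_f∂_eW)∧da_f, by integration by parts. Multiply (b) by G(U_v), sum over v and insert G
applied to (a). The left side becomes (2/a_e) A·∂_eA, since X∧da_f∧X = 0 for X = G_f(∂_eW) odd. The
right side vanishes, since da_f occurs twice or ∂_e∂_e = 0.

Vanishing of Q_E. Expanding all sums, a term is a pair of words spelling E together with a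
permutation ρ that matches their positions. For fixed ρ the factors ψ sit on the edges of a
2-regular graph on the 2L positions, in which matching edges alternate with edges {2k, 2k+1}; its
cycles are therefore even. Rotating one cycle by a step is an odd permutation of positions that
preserves the edge set. Since ψ is symmetric, it preserves the weight and flips the sign, so the sum
over spellings is its own negative (`sum_spelling_eq_zero`). -/

namespace ExteriorAlgebra

open CliffordAlgebra (involute contractRight)

/-! ### Parity and contractions in the exterior algebra -/

section Contraction

variable {R M N : Type*} [CommRing R] [AddCommGroup M] [Module R M] [AddCommGroup N] [Module R N]

theorem ι_mul_eq_involute_mul_ι (v : M) (x : ExteriorAlgebra R M) :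
    ι R v * x = involute x * ι R v := by
  induction x using ExteriorAlgebra.induction with
  | algebraMap r => simp [Algebra.commutes]
  | ι w =>
    have h := ExteriorAlgebra.ι_add_mul_swap (R := R) v w
    rw [CliffordAlgebra.involute_ι, neg_mul]
    exact eq_neg_of_add_eq_zero_left h
  | mul a b ha hb => rw [← mul_assoc, ha, mul_assoc, hb, ← mul_assoc, map_mul]
  | add a b ha hb => rw [mul_add, ha, hb, map_add, add_mul]

theorem mul_eq_involute_mul_of_odd {x : ExteriorAlgebra R M} (hx : involute x = -x)
    (y : ExteriorAlgebra R M) : x * y = involute y * x := by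
  induction y using ExteriorAlgebra.induction with
  | algebraMap r => simp [Algebra.commutes]
  | ι w =>
    have h := ι_mul_eq_involute_mul_ι w x
    rw [CliffordAlgebra.involute_ι, neg_mul, h, hx, neg_mul, neg_neg]
  | mul a b ha hb => rw [← mul_assoc, ha, mul_assoc, hb, ← mul_assoc, map_mul]
  | add a b ha hb => rw [mul_add, ha, hb, map_add, add_mul]

theorem mul_comm_of_even {x : ExteriorAlgebra R M} (hx : involute x = x)
    (y : ExteriorAlgebra R M) : x * y = y * x := by
  induction y using ExteriorAlgebra.induction with
  | algebraMap r => simp [Algebra.commutes]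
  | ι w => rw [ι_mul_eq_involute_mul_ι w x, hx]
  | mul a b ha hb => rw [← mul_assoc, ha, mul_assoc, hb, ← mul_assoc]
  | add a b ha hb => rw [mul_add, ha, hb, add_mul]

theorem mul_self_eq_zero_of_odd [IsAddTorsionFree (ExteriorAlgebra R M)]
    {x : ExteriorAlgebra R M} (hx : involute x = -x) : x * x = 0 := by
  have h := mul_eq_involute_mul_of_odd hx x
  rw [hx, neg_mul] at h
  exact self_eq_neg.mp h

theorem ι_mul_mul_ι (v : M) (x : ExteriorAlgebra R M) : ι R v * x * ι R v = 0 := by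
  rw [ι_mul_eq_involute_mul_ι, mul_assoc, ι_sq_zero, mul_zero]

/-- Moving the vector past the second factor leaves `x * x` up to sign, which vanishes for odd `x`.
-/
theorem odd_mul_ι_mul_self [IsAddTorsionFree (ExteriorAlgebra R M)]
    {x : ExteriorAlgebra R M} (hx : involute x = -x) (v : M) : x * ι R v * x = 0 := by
  rw [mul_assoc, ι_mul_eq_involute_mul_ι, hx, neg_mul, mul_neg, ← mul_assoc,
    mul_self_eq_zero_of_odd hx, zero_mul, neg_zero]

theorem contractRight_mul (x y : ExteriorAlgebra R M) (d : Dual R M) :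
    contractRight (x * y) d = x * contractRight y d + contractRight x d * involute y := by
  induction y using ExteriorAlgebra.induction generalizing x with
  | algebraMap r => simp [CliffordAlgebra.contractRight_mul_algebraMap]
  | ι w =>
    rw [CliffordAlgebra.contractRight_mul_ι, CliffordAlgebra.contractRight_ι,
      CliffordAlgebra.involute_ι, ← Algebra.commutes, ← Algebra.smul_def, mul_neg, sub_eq_add_neg]
  | mul a b ha hb =>
    rw [← mul_assoc, hb, ha, hb a, map_mul]
    simp only [mul_add, add_mul, mul_assoc, add_assoc]
  | add a b ha hb =>
    simp only [mul_add, map_add, LinearMap.add_apply, ha, hb]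
    abel

theorem involute_contractRight (x : ExteriorAlgebra R M) (d : Dual R M) :
    involute (contractRight x d) = -contractRight (involute x) d := by
  induction x using ExteriorAlgebra.induction with
  | algebraMap r => simp
  | ι w => simp
  | mul a b ha hb =>
    simp only [contractRight_mul, map_mul, map_add, ha, hb, CliffordAlgebra.involute_involute]
    rw [neg_add, mul_neg, neg_mul]
  | add a b ha hb =>
    simp only [map_add, LinearMap.add_apply, ha, hb]
    abel

theorem involute_map (f : M →ₗ[R] N) (x : ExteriorAlgebra R M) :
    involute (map f x) = map f (involute x) := by
  induction x using ExteriorAlgebra.induction with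
  | algebraMap r => simp
  | ι w => simp
  | mul a b ha hb => simp only [map_mul, ha, hb]
  | add a b ha hb => simp only [map_add, ha, hb]

theorem contractRight_map (f : M →ₗ[R] N) (x : ExteriorAlgebra R M) (d : Dual R N) :
    contractRight (map f x) d = map f (contractRight x (d ∘ₗ f)) := by
  induction x using ExteriorAlgebra.induction with
  | algebraMap r => simp
  | ι w => simp
  | mul a b ha hb => simp only [map_mul, contractRight_mul, ha, hb, map_add, involute_map]
  | add a b ha hb => simp only [map_add, LinearMap.add_apply, ha, hb]

/-- The iterated right contraction with a list of functionals, the last one being applied first. -/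
noncomputable def contractList (l : List (Dual R M)) (x : ExteriorAlgebra R M) :
    ExteriorAlgebra R M :=
  l.foldr (fun d y => contractRight y d) x

@[simp] theorem contractList_nil (x : ExteriorAlgebra R M) : contractList [] x = x := rfl

@[simp] theorem contractList_cons (d : Dual R M) (l : List (Dual R M)) (x : ExteriorAlgebra R M) :
    contractList (d :: l) x = contractRight (contractList l x) d := rfl

@[simp] theorem contractList_zero (l : List (Dual R M)) :
    contractList l (0 : ExteriorAlgebra R M) = 0 := by
  induction l with
  | nil => rfl
  | cons d l ih => simp [ih]

theorem contractList_add (l : List (Dual R M)) (x y : ExteriorAlgebra R M) :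
    contractList l (x + y) = contractList l x + contractList l y := by
  induction l with
  | nil => rfl
  | cons d l ih => simp [ih]

theorem contractList_smul (l : List (Dual R M)) (c : R) (x : ExteriorAlgebra R M) :
    contractList l (c • x) = c • contractList l x := by
  induction l with
  | nil => rfl
  | cons d l ih => simp [ih]

/-- `contractList` as a linear map. -/
noncomputable def contractListHom (l : List (Dual R M)) :
    ExteriorAlgebra R M →ₗ[R] ExteriorAlgebra R M where
  toFun := contractList l
  map_add' := contractList_add l
  map_smul' := contractList_smul l

theorem involute_contractList (l : List (Dual R M)) (x : ExteriorAlgebra R M) :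
    involute (contractList l x) = (-1 : R) ^ l.length • contractList l (involute x) := by
  induction l with
  | nil => simp
  | cons d l ih => simp [involute_contractRight, ih, pow_succ]

theorem contractList_map (f : M →ₗ[R] N) (l : List (Dual R N)) (x : ExteriorAlgebra R M) :
    contractList l (map f x) = map f (contractList (l.map fun d => d ∘ₗ f) x) := by
  induction l with
  | nil => rfl
  | cons d l ih => simp [ih, contractRight_map]

theorem contractRight_contractList (l : List (Dual R M)) (x : ExteriorAlgebra R M) (d : Dual R M) :
    contractRight (contractList l x) d = (-1 : R) ^ l.length • contractList l (contractRight x d) := by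
  induction l with
  | nil => simp
  | cons e l ih =>
    rw [contractList_cons, CliffordAlgebra.contractRight_comm, ih, contractList_cons]
    simp [pow_succ]

theorem contractRight_contractList_of_mem {l : List (Dual R M)} {d : Dual R M} (hd : d ∈ l)
    (x : ExteriorAlgebra R M) : contractRight (contractList l x) d = 0 := by
  induction l with
  | nil => simp at hd
  | cons e l ih =>
    rw [contractList_cons]
    rcases List.mem_cons.mp hd with rfl | h
    · exact CliffordAlgebra.contractRight_contractRight _ _
    · rw [CliffordAlgebra.contractRight_comm, ih h]
      simp

theorem contractList_eq_zero_of_mem {l : List (Dual R M)} {d : Dual R M} (hd : d ∈ l)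
    {x : ExteriorAlgebra R M} (hx : contractRight x d = 0) : contractList l x = 0 := by
  induction l with
  | nil => simp at hd
  | cons e l ih =>
    rw [contractList_cons]
    rcases List.mem_cons.mp hd with rfl | h
    · rw [contractRight_contractList, hx]; simp
    · rw [ih h]; simp

/-- Contract the equation `x * ι R p = 0` with one functional at a time: by the Leibniz rule each
contraction adds one term proportional to `d v p`. The `U v` are built from partial contractions of
`x` alone, so one family serves all `p`. -/
theorem exists_contractList_mul_ι {n : ℕ} (d : Fin n → Dual R M) (x : ExteriorAlgebra R M) :
    ∃ U : Fin n → ExteriorAlgebra R M, ∀ p : M, x * ι R p = 0 →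
      contractList (List.ofFn d) x * ι R p = ∑ v, d v p • U v := by
  induction n with
  | zero => exact ⟨fun _ => 0, fun p hp => by simpa using hp⟩
  | succ n ih =>
    obtain ⟨U, hU⟩ := ih (fun i => d i.succ)
    refine ⟨Fin.cons (contractList (List.ofFn fun i => d i.succ) x)
      (fun v => -contractRight (U v) (d 0)), fun p hp => ?_⟩
    have h1 := CliffordAlgebra.contractRight_mul_ι (d 0) p
      (contractList (List.ofFn fun i => d i.succ) x)
    rw [List.ofFn_succ, contractList_cons, Fin.sum_univ_succ, ← sub_eq_iff_eq_add'.mpr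
      (sub_eq_iff_eq_add.mp h1.symm), hU p hp]
    simp [map_sum, LinearMap.sum_apply, sub_eq_add_neg]

end Contraction

section Field

variable {K M : Type*} [Field K] [AddCommGroup M] [Module K M]

/-- Contractions anticommute and square to zero, so the iterated contraction is alternating in the
functionals. A functional with nonzero coefficient can be traded for the combination, which kills
`x`. -/
theorem contractList_eq_zero_of_combination {n : ℕ} (d : Fin n → Dual K M) {c : Fin n → K}
    (hc : c ≠ 0) {x : ExteriorAlgebra K M} (hx : contractRight x (∑ v, c v • d v) = 0) :
    contractList (List.ofFn d) x = 0 := by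
  induction n with
  | zero => exact absurd (Subsingleton.elim _ _) hc
  | succ n ih =>
    rw [List.ofFn_succ, contractList_cons]
    by_cases h0 : c 0 = 0
    · rw [ih (fun i => d i.succ) (c := fun i => c i.succ), map_zero, LinearMap.zero_apply]
      · intro h
        apply hc
        ext i
        refine Fin.cases h0 (fun i => congrFun h i) i
      · rwa [Fin.sum_univ_succ, h0, zero_smul, zero_add] at hx
    · have key : c 0 • contractRight (contractList (List.ofFn fun i => d i.succ) x) (d 0) = 0 := by
        have h1 := contractRight_contractList (List.ofFn fun i => d i.succ) x (∑ v, c v • d v)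
        rw [hx, contractList_zero, smul_zero, Fin.sum_univ_succ, map_add, map_sum, map_smul] at h1
        rw [← h1, eq_comm, add_eq_left]
        refine Finset.sum_eq_zero fun i _ => ?_
        rw [map_smul, contractRight_contractList_of_mem, smul_zero]
        simp
      exact (smul_eq_zero.mp key).resolve_left h0

end Field

section Basis

variable {R M : Type*} [CommRing R] [AddCommGroup M] [Module R M]

theorem basis_eq_prod {I : Type*} [LinearOrder I] (b : Basis I R M) {k : ℕ} (s : Finset I)
    (h : s.card = k) :
    b.ExteriorAlgebra s = (List.ofFn fun i => ι R (b (s.orderEmbOfFin h i))).prod := by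
  rw [basis_apply_ofCard b h, ιMulti_family, ιMulti_apply]
  rfl

theorem contractRight_prod_eq_zero (l : List M) {d : Dual R M} (h : ∀ p ∈ l, d p = 0) :
    contractRight (l.map (ι R)).prod d = 0 := by
  induction l with
  | nil => simp
  | cons p l ih =>
    rw [List.map_cons, List.prod_cons, contractRight_mul, ih fun q hq => h q (by simp [hq]),
      CliffordAlgebra.contractRight_ι, h p (by simp)]
    simp

/-- The last functional acts first, so the factors are peeled off from the right end and no sign
appears. -/
theorem contractList_mul_prod {n : ℕ} (d : Fin n → Dual R M) (p : Fin n → M)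
    (hd : ∀ i j, d i (p j) = if i = j then 1 else 0) {x : ExteriorAlgebra R M}
    (hx : ∀ i, contractRight x (d i) = 0) :
    contractList (List.ofFn d) (x * (List.ofFn fun i => ι R (p i)).prod) = x := by
  induction n generalizing x with
  | zero => simp
  | succ n ih =>
    rw [List.ofFn_succ, List.ofFn_succ, contractList_cons, List.prod_cons, ← mul_assoc, ih]
    · rw [CliffordAlgebra.contractRight_mul_ι, hx, hd]; simp
    · intro i j; rw [hd]; simp
    · intro i
      rw [CliffordAlgebra.contractRight_mul_ι, hx, hd]; simp [Fin.succ_ne_zero]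

end Basis

end ExteriorAlgebra

namespace ExteriorAlgebra

open CliffordAlgebra (involute contractRight)

/-! ### Contractions and diagonal maps on basis monomials -/

section Basis

variable {R M I : Type*} [CommRing R] [AddCommGroup M] [Module R M] [LinearOrder I]
  (b : Basis I R M)

theorem prod_map_ι_mul_ι_eq_zero {l : List M} {p : M} (h : p ∈ l) :
    (l.map (ι R)).prod * ι R p = 0 := by
  induction l with
  | nil => simp at h
  | cons q l ih =>
    rw [List.map_cons, List.prod_cons]
    rcases List.mem_cons.mp h with rfl | h
    · exact ι_mul_mul_ι _ _
    · rw [mul_assoc, ih h, mul_zero]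

theorem basis_eq_prod_map (s : Finset I) :
    b.ExteriorAlgebra s =
      ((List.ofFn fun i => b (s.orderEmbOfFin rfl i)).map (ι R)).prod := by
  rw [basis_eq_prod b s rfl, List.map_ofFn]
  rfl

theorem contractRight_basis_of_forall {s : Finset I} {d : Dual R M} (h : ∀ i ∈ s, d (b i) = 0) :
    contractRight (b.ExteriorAlgebra s) d = 0 := by
  rw [basis_eq_prod_map]
  refine contractRight_prod_eq_zero _ fun p hp => ?_
  obtain ⟨i, rfl⟩ := (List.mem_ofFn' _ _).mp hp
  exact h _ (Finset.orderEmbOfFin_mem _ _ _)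

theorem basis_mul_ι_of_mem {s : Finset I} {i : I} (h : i ∈ s) :
    b.ExteriorAlgebra s * ι R (b i) = 0 := by
  rw [basis_eq_prod_map]
  refine prod_map_ι_mul_ι_eq_zero ((List.mem_ofFn' _ _).mpr ?_)
  have h' : i ∈ Set.range (s.orderEmbOfFin rfl) := by simpa using h
  obtain ⟨j, hj⟩ := h'
  exact ⟨j, by simp [hj]⟩

/-- Apply the Leibniz rule to the vanishing product of a monomial with one of its own factors.
Contracting and multiplying back is thus a projection. -/
theorem contractRight_basis_mul_ι (s : Finset I) (i : I) :
    contractRight (b.ExteriorAlgebra s) (b.coord i) * ι R (b i) =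
      if i ∈ s then b.ExteriorAlgebra s else 0 := by
  split_ifs with h
  · have h1 := CliffordAlgebra.contractRight_mul_ι (b.coord i) (b i) (b.ExteriorAlgebra s)
    rw [basis_mul_ι_of_mem b h, map_zero, LinearMap.zero_apply] at h1
    simpa using (sub_eq_zero.mp h1.symm).symm
  · rw [contractRight_basis_of_forall, zero_mul]
    intro j hj
    have : j ≠ i := fun e => h (e ▸ hj)
    simp [this]

theorem map_basis {f : M →ₗ[R] M} {c : I → R} (hf : ∀ i, f (b i) = c i • b i) (s : Finset I) :
    map f (b.ExteriorAlgebra s) = (∏ i ∈ s, c i) • b.ExteriorAlgebra s := by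
  rw [basis_apply_ofCard b rfl, ιMulti_family, map_apply_ιMulti]
  have : (f ∘ b ∘ Set.powersetCard.ofFinEmbEquiv.symm (Set.powersetCard.ofCard (rfl : s.card = _))) =
      fun i => c (s.orderEmbOfFin rfl i) • b (s.orderEmbOfFin rfl i) := by
    ext i; simp [hf, Set.powersetCard.ofFinEmbEquiv_symm_apply]
  rw [this, AlternatingMap.map_smul_univ]
  congr 1
  rw [← Finset.prod_image (s := Finset.univ) (g := s.orderEmbOfFin rfl) (f := c)]
  · simp
  · exact (s.orderEmbOfFin rfl).injective.injOn

theorem algebraMapInv_basis (s : Finset I) :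
    algebraMapInv (b.ExteriorAlgebra s) = if s = ∅ then 1 else 0 := by
  rw [basis_eq_prod b s rfl]
  split_ifs with h
  · subst h; simp
  · have : s.card ≠ 0 := by simpa using h
    rw [map_list_prod, List.prod_eq_zero]
    obtain ⟨k, hk⟩ := Nat.exists_eq_succ_of_ne_zero this
    simp only [List.map_ofFn, List.mem_ofFn', Set.mem_range]
    refine ⟨⟨0, by omega⟩, ?_⟩
    simp [algebraMapInv]

theorem repr_contractRight_mul_ι [Fintype I] (x : ExteriorAlgebra R M) (i : I) (s : Finset I) :
    b.ExteriorAlgebra.repr (contractRight x (b.coord i) * ι R (b i)) s =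
      if i ∈ s then b.ExteriorAlgebra.repr x s else 0 := by
  classical
  conv_lhs => rw [← b.ExteriorAlgebra.sum_repr x]
  simp only [map_sum, map_smul, LinearMap.sum_apply, LinearMap.smul_apply, Finset.sum_mul,
    smul_mul_assoc, contractRight_basis_mul_ι, Finsupp.finsetSum_apply]
  rw [Finset.sum_eq_single s]
  · split_ifs <;> simp
  · intro t _ ht
    split_ifs <;> simp [ht]
  · simp

theorem repr_map [Fintype I] {f : M →ₗ[R] M} {c : I → R} (hf : ∀ i, f (b i) = c i • b i)
    (x : ExteriorAlgebra R M) (s : Finset I) :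
    b.ExteriorAlgebra.repr (map f x) s = (∏ i ∈ s, c i) * b.ExteriorAlgebra.repr x s := by
  classical
  conv_lhs => rw [← b.ExteriorAlgebra.sum_repr x]
  simp only [map_sum, map_smul, map_basis b hf, Finsupp.finsetSum_apply]
  rw [Finset.sum_eq_single s]
  · simp [mul_comm]
  · intro t _ ht
    simp [ht]
  · simp

theorem eq_zero_of_contractRight_eq_zero [Fintype I] {x : ExteriorAlgebra R M}
    (h : ∀ i, contractRight x (b.coord i) = 0) (h0 : algebraMapInv x = 0) : x = 0 := by
  classical
  have h1 : ∀ s : Finset I, s ≠ ∅ → b.ExteriorAlgebra.repr x s = 0 := by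
    intro s hs
    obtain ⟨i, hi⟩ := Finset.nonempty_iff_ne_empty.mpr hs
    have := repr_contractRight_mul_ι b x i s
    rw [h, zero_mul, if_pos hi] at this
    simpa using this.symm
  have h2 : x = b.ExteriorAlgebra.repr x ∅ • b.ExteriorAlgebra ∅ := by
    conv_lhs => rw [← b.ExteriorAlgebra.sum_repr x]
    exact Finset.sum_eq_single _ (fun s _ hs => by rw [h1 s hs, zero_smul]) (by simp)
  rw [h2, map_smul, algebraMapInv_basis, if_pos rfl, smul_eq_mul, mul_one] at h0
  rw [h2, h0, zero_smul]

end Basis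

end ExteriorAlgebra

/-! ### The coefficients of the integrand and the cycle form -/

noncomputable section

namespace FeynmanGraph

open CliffordAlgebra (involute contractRight)
open ExteriorAlgebra (contractList ι)

variable {n m : ℕ} (Γ : FeynmanGraph n m)

/-- The linear map that sends the positions of the vertices to the differences along the edges. -/
def edgeMap : (Fin n → ℝ) →ₗ[ℝ] (Fin m → ℝ) where
  toFun x e := position x (Γ.tgt e) - position x (Γ.src e)
  map_add' x y := by
    have h : ∀ v, position (x + y) v = position x v + position y v := by
      intro v; refine Fin.lastCases ?_ (fun i => ?_) v <;> simp [position]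
    ext e; simp only [h, Pi.add_apply]; ring
  map_smul' c x := by
    have h : ∀ v, position (c • x) v = c * position x v := by
      intro v; refine Fin.lastCases ?_ (fun i => ?_) v <;> simp [position]
    ext e; simp only [h, Pi.smul_apply, smul_eq_mul, RingHom.id_apply]; ring

theorem edgeVar_eq (e : Fin m) (p : TotalSpace n m) :
    Γ.edgeVar e p = Γ.edgeMap p.2 e / √(p.1 e) := rfl

/-- The forms `da_e` on the total space. -/
def paramForm (n : ℕ) {m : ℕ} (e : Fin m) : Dual ℝ (TotalSpace n m) :=
  LinearMap.proj e ∘ₗ LinearMap.fst ℝ _ _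

/-- The differences `dx_e = dx_e^+ - dx_e^-` as forms on the total space. -/
def diffForm (e : Fin m) : Dual ℝ (TotalSpace n m) :=
  LinearMap.proj e ∘ₗ Γ.edgeMap ∘ₗ LinearMap.snd ℝ _ _

theorem dEdgeVar_eq {a : Fin m → ℝ} (e : Fin m) (ha : 0 < a e) (x : Fin n → ℝ) :
    Γ.dEdgeVar e (a, x) =
      (√(a e))⁻¹ • (Γ.diffForm e - (Γ.edgeMap x e / (2 * a e)) • paramForm n e) := by
  have hs : √(a e) ≠ 0 := (Real.sqrt_pos.mpr ha).ne'
  have h1 : HasFDerivAt (fun p : TotalSpace n m => Γ.edgeMap p.2 e)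
      (LinearMap.toContinuousLinearMap (Γ.diffForm e)) (a, x) :=
    (LinearMap.toContinuousLinearMap (Γ.diffForm e)).hasFDerivAt
  have h2 : HasFDerivAt (fun p : TotalSpace n m => p.1 e)
      (LinearMap.toContinuousLinearMap (paramForm n e)) (a, x) :=
    (LinearMap.toContinuousLinearMap (paramForm n e)).hasFDerivAt
  have h3 := h1.mul ((hasDerivAt_inv hs).comp_hasFDerivAt (a, x)
    ((Real.hasDerivAt_sqrt ha.ne').comp_hasFDerivAt (a, x) h2))
  have h4 : HasFDerivAt (Γ.edgeVar e) _ (a, x) := h3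
  rw [dEdgeVar, h4.fderiv]
  refine LinearMap.ext fun p => ?_
  have hsq : √(a e) ^ 2 = a e := Real.sq_sqrt ha.le
  simp only [ContinuousLinearMap.coe_coe, add_apply,
    smul_apply, LinearMap.coe_toContinuousLinearMap', Function.comp_apply,
    LinearMap.smul_apply, LinearMap.sub_apply, smul_eq_mul]
  rw [hsq]
  field_simp
  ring

@[simp] theorem coordForms_castAdd (e : Fin m) :
    coordForms n m (Fin.castAdd n e) = paramForm n e := by
  refine LinearMap.ext fun p => ?_
  simp [coordForms, paramForm]

theorem coordForms_natAdd (v : Fin n) :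
    coordForms n m (Fin.natAdd m v) = LinearMap.proj v ∘ₗ LinearMap.snd ℝ _ _ := by
  refine LinearMap.ext fun p => ?_
  simp [coordForms]

/-- The basis `da_1, …, da_m` of the 1-forms on the space of Schwinger parameters. -/
abbrev dParam (m : ℕ) : Basis (Fin m) ℝ (Dual ℝ (Fin m → ℝ)) := (Pi.basisFun ℝ (Fin m)).dualBasis

/-- The vector `∂/∂x_v`, as a functional on the 1-forms of the total space. -/
def vertexVector (m : ℕ) (v : Fin n) : Dual ℝ (Dual ℝ (TotalSpace n m)) :=
  Dual.eval ℝ _ (0, Pi.single v 1)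

/-- The column of the incidence matrix at the vertex `v`, as a functional on the span of the edges. -/
def column (v : Fin n) : Dual ℝ (Dual ℝ (Fin m → ℝ)) := Dual.eval ℝ _ (Γ.edgeMap (Pi.single v 1))

theorem vertexVector_coordForms (v : Fin n) (i : Fin (m + n)) :
    vertexVector m v (coordForms n m i) = if i = Fin.natAdd m v then 1 else 0 := by
  refine Fin.addCases (fun e => ?_) (fun w => ?_) i
  · rw [coordForms_castAdd]
    have : Fin.castAdd n e ≠ Fin.natAdd m v := by
      intro h; have := congrArg Fin.val h; simp at this; omega
    simp [vertexVector, paramForm, this]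
  · rw [coordForms_natAdd]
    simp [vertexVector, Pi.single_apply]

/-- The restriction of 1-forms to the directions of the Schwinger parameters. -/
def restrictParam (n m : ℕ) : Dual ℝ (TotalSpace n m) →ₗ[ℝ] Dual ℝ (Fin m → ℝ) :=
  (LinearMap.inl ℝ (Fin m → ℝ) (Fin n → ℝ)).dualMap

theorem restrictParam_paramForm (e : Fin m) : restrictParam n m (paramForm n e) = dParam m e := by
  refine LinearMap.ext fun p => ?_
  simp [restrictParam, paramForm]

theorem restrictParam_diffForm (e : Fin m) : restrictParam n m (Γ.diffForm e) = 0 := by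
  refine LinearMap.ext fun p => ?_
  simp [restrictParam, diffForm]

theorem mem_withAllPositions_natAdd (S : Finset (Fin m)) (v : Fin n) :
    Fin.natAdd m v ∈ withAllPositions n S := by
  simp [withAllPositions]

theorem mem_withAllPositions_castAdd (S : Finset (Fin m)) (e : Fin m) :
    Fin.castAdd n e ∈ withAllPositions n S ↔ e ∈ S := by
  have : ∀ v : Fin n, Fin.natAdd m v ≠ Fin.castAdd n e := by
    intro v h; have := congrArg Fin.val h; simp at this; omega
  simp [withAllPositions, this]

theorem withAllPositions_injective :
    Function.Injective (withAllPositions n : Finset (Fin m) → Finset (Fin (m + n))) := by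
  intro S T h
  ext e
  rw [← mem_withAllPositions_castAdd (n := n), h, mem_withAllPositions_castAdd]

theorem exists_eq_withAllPositions {T : Finset (Fin (m + n))} (h : ∀ v, Fin.natAdd m v ∈ T) :
    ∃ S, T = withAllPositions n S := by
  refine ⟨Finset.univ.filter fun e => Fin.castAdd n e ∈ T, ?_⟩
  ext i
  refine Fin.addCases (fun e => ?_) (fun v => ?_) i
  · rw [mem_withAllPositions_castAdd]; simp
  · simp [h, mem_withAllPositions_natAdd]

theorem coordForms_withAllPositions (S : Finset (Fin m)) :
    (coordForms n m).ExteriorAlgebra (withAllPositions n S) =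
      (List.ofFn fun i => ι ℝ (paramForm n (S.orderEmbOfFin rfl i))).prod *
        (List.ofFn fun v => ι ℝ (coordForms n m (Fin.natAdd m v))).prod := by
  have hcard : (withAllPositions n S).card = S.card + n := by
    rw [withAllPositions, Finset.card_union_of_disjoint]
    · simp
    · rw [Finset.disjoint_left]
      intro i hi hj
      obtain ⟨e, _, rfl⟩ := Finset.mem_map.mp hi
      obtain ⟨v, _, hv⟩ := Finset.mem_map.mp hj
      have := congrArg Fin.val hv
      simp at this; omega
  have hf : Fin.append (fun i => Fin.castAdd n (S.orderEmbOfFin rfl i)) (Fin.natAdd m) =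
      (withAllPositions n S).orderEmbOfFin hcard := by
    refine Finset.orderEmbOfFin_unique _ (fun i => ?_) ?_
    · refine Fin.addCases (fun e => ?_) (fun v => ?_) i
      · simp [mem_withAllPositions_castAdd]
      · simp [mem_withAllPositions_natAdd]
    · intro i j
      refine Fin.addCases (fun e => ?_) (fun v => ?_) i <;>
      refine Fin.addCases (fun e' => ?_) (fun v' => ?_) j <;> intro hij
      · rw [Fin.append_left, Fin.append_left]
        have h : e < e' := hij
        exact Fin.lt_def.mp ((S.orderEmbOfFin rfl).strictMono h)
      · rw [Fin.append_left, Fin.append_right, Fin.lt_def, Fin.val_castAdd, Fin.val_natAdd]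
        omega
      · rw [Fin.lt_def, Fin.val_castAdd, Fin.val_natAdd] at hij
        omega
      · rw [Fin.append_right, Fin.append_right]
        exact (Fin.natAdd_lt_natAdd_iff m).mpr ((Fin.natAdd_lt_natAdd_iff _).mp hij)
  rw [ExteriorAlgebra.basis_eq_prod _ _ hcard, ← hf, ← List.prod_append, ← List.ofFn_fin_append]
  congr 2
  ext i
  refine Fin.addCases (fun e => ?_) (fun v => ?_) i <;> simp

/-- Contraction with all ∂/∂x_v kills monomials that lack some dx_v and strips dx_1∧…∧dx_n off the
others. The point of this form is that contraction and restriction are compatible with linear maps,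
so no minors need to be expanded. -/
theorem repr_withAllPositions (z : ExteriorAlgebra ℝ (Dual ℝ (TotalSpace n m)))
    (S : Finset (Fin m)) :
    (coordForms n m).ExteriorAlgebra.repr z (withAllPositions n S) =
      (edgeForms m).repr (ExteriorAlgebra.map (restrictParam n m)
        (contractList (List.ofFn (vertexVector m)) z)) S := by
  have key : (Finsupp.lapply (withAllPositions n S) : (Finset (Fin (m + n)) →₀ ℝ) →ₗ[ℝ] ℝ) ∘ₗ
      ((coordForms n m).ExteriorAlgebra.repr : _ →ₗ[ℝ] _) =
      (Finsupp.lapply S : (Finset (Fin m) →₀ ℝ) →ₗ[ℝ] ℝ) ∘ₗ ((edgeForms m).repr : _ →ₗ[ℝ] _) ∘ₗ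
        (ExteriorAlgebra.map (restrictParam n m)).toLinearMap ∘ₗ
        ExteriorAlgebra.contractListHom (List.ofFn (vertexVector m)) := by
    refine (coordForms n m).ExteriorAlgebra.ext fun T => ?_
    simp only [LinearMap.comp_apply, LinearEquiv.coe_coe, Basis.repr_self, Finsupp.lapply_apply,
      AlgHom.toLinearMap_apply]
    change _ = (edgeForms m).repr (ExteriorAlgebra.map (restrictParam n m)
      (contractList (List.ofFn (vertexVector m)) _)) S
    by_cases hT : ∀ v, Fin.natAdd m v ∈ T
    · obtain ⟨S', rfl⟩ := exists_eq_withAllPositions hT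
      rw [coordForms_withAllPositions, ExteriorAlgebra.contractList_mul_prod, map_list_prod,
        List.map_ofFn]
      · have : (List.ofFn ((ExteriorAlgebra.map (restrictParam n m)) ∘
            fun i => ι ℝ (paramForm n (S'.orderEmbOfFin rfl i)))).prod = edgeForms m S' := by
          rw [edgeForms, ExteriorAlgebra.basis_eq_prod _ _ rfl]
          congr 2
          ext i
          simp [restrictParam_paramForm]
        rw [this, Basis.repr_self]
        simp only [Finsupp.single_apply, withAllPositions_injective.eq_iff]
      · intro i j
        rw [vertexVector_coordForms]
        simp [eq_comm]
      · intro v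
        have := ExteriorAlgebra.contractRight_prod_eq_zero (R := ℝ)
          (List.ofFn fun i => paramForm n (S'.orderEmbOfFin rfl i)) (d := vertexVector m v) ?_
        · rwa [List.map_ofFn] at this
        · intro p hp
          obtain ⟨i, rfl⟩ := (List.mem_ofFn' _ _).mp hp
          simp [vertexVector, paramForm]
    · push Not at hT
      obtain ⟨v, hv⟩ := hT
      rw [ExteriorAlgebra.contractList_eq_zero_of_mem (d := vertexVector m v)]
      · have : T ≠ withAllPositions n S := fun h => hv (h ▸ mem_withAllPositions_natAdd S v)
        simp [this]
      · simp
      · refine ExteriorAlgebra.contractRight_basis_of_forall _ fun i hi => ?_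
        rw [vertexVector_coordForms, if_neg]
        rintro rfl; exact hv hi
  exact LinearMap.congr_fun key z

/-- The decomposable multivector of the cycle space: the contraction of `⋀_e da_e` with all the columns
of the incidence matrix. -/
def cycleForm : ExteriorAlgebra ℝ (Dual ℝ (Fin m → ℝ)) :=
  contractList (List.ofFn Γ.column) (edgeForms m Finset.univ)

/-- The exponent `∑ s_e²` of the Gaussian weight. -/
def energy (a : Fin m → ℝ) (x : Fin n → ℝ) : ℝ := ∑ e, Γ.edgeMap x e ^ 2 / a e

theorem edgeForms_univ :
    edgeForms m Finset.univ = ExteriorAlgebra.ιMulti ℝ m (dParam m) := by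
  rw [edgeForms, ExteriorAlgebra.basis_eq_prod _ _ (Finset.card_fin m),
    ExteriorAlgebra.ιMulti_apply]
  have : (id : Fin m → Fin m) = Finset.univ.orderEmbOfFin (Finset.card_fin m) :=
    Finset.orderEmbOfFin_unique _ (by simp) strictMono_id
  rw [← this]
  rfl

theorem fiberCoeff_eq {a : Fin m → ℝ} (ha : ∀ e, 0 < a e) (S : Finset (Fin m)) (x : Fin n → ℝ) :
    Γ.fiberCoeff a S x =
      (∏ e, (√(a e))⁻¹) * (∏ e ∈ S, -(2 * a e)⁻¹) * (edgeForms m).repr Γ.cycleForm S *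
        ((∏ e ∈ S, Γ.edgeMap x e) * Real.exp (-Γ.energy a x)) := by
  -- ds_e is a multiple of F(da_e), so the integrand is a multiple of the image of the top form ⋀
  -- da_e under F.
  set F : Dual ℝ (Fin m → ℝ) →ₗ[ℝ] Dual ℝ (TotalSpace n m) := (dParam m).constr ℝ fun e =>
    Γ.diffForm e - (Γ.edgeMap x e / (2 * a e)) • paramForm n e with hF
  have hFe : ∀ e, F (dParam m e) =
      Γ.diffForm e - (Γ.edgeMap x e / (2 * a e)) • paramForm n e := fun e => by
    rw [hF, Basis.constr_basis]
  have h1 : Γ.integrand (a, x) = ((∏ e, (√(a e))⁻¹) * Real.exp (-Γ.energy a x)) •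
      ExteriorAlgebra.map F (edgeForms m Finset.univ) := by
    rw [edgeForms_univ, ExteriorAlgebra.map_apply_ιMulti, integrand]
    have : (fun e => Real.exp (-(Γ.edgeVar e (a, x)) ^ 2) • Γ.dEdgeVar e (a, x)) =
        fun e => ((√(a e))⁻¹ * Real.exp (-(Γ.edgeVar e (a, x)) ^ 2)) • (F ∘ dParam m) e := by
      ext1 e
      rw [Γ.dEdgeVar_eq e (ha e) x, Function.comp_apply, hFe, smul_smul, mul_comm]
    have hE : ∑ e, -(Γ.edgeVar e (a, x)) ^ 2 = -Γ.energy a x := by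
      rw [energy, ← Finset.sum_neg_distrib]
      refine Finset.sum_congr rfl fun e _ => ?_
      rw [edgeVar_eq, div_pow, Real.sq_sqrt (ha e).le]
    rw [this, AlternatingMap.map_smul_univ, Finset.prod_mul_distrib, ← Real.exp_sum, hE]
  -- ∂/∂x_v sees only the dx_e part of F(da_e); pulled back along F it no longer depends on x.
  have h2 : (List.ofFn (vertexVector m)).map (fun d => d ∘ₗ F) = List.ofFn Γ.column := by
    rw [List.map_ofFn]
    congr 1
    ext1 v
    refine (dParam m).ext fun e => ?_
    simp only [Function.comp_apply, LinearMap.comp_apply]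
    rw [hFe]
    simp [vertexVector, column, diffForm, paramForm]
  -- The restriction discards dx_e, so what remains of F is diagonal.
  have h3 : ∀ e, (restrictParam n m ∘ₗ F) (dParam m e) =
      (-(2 * a e)⁻¹ * Γ.edgeMap x e) • dParam m e := by
    intro e
    rw [LinearMap.comp_apply, hFe, map_sub, map_smul, restrictParam_diffForm,
      restrictParam_paramForm, zero_sub, show -(2 * a e)⁻¹ * Γ.edgeMap x e =
        -(Γ.edgeMap x e / (2 * a e)) by rw [div_eq_mul_inv]; ring]
    exact (neg_smul _ _).symm
  rw [fiberCoeff, h1, map_smul, Finsupp.smul_apply, repr_withAllPositions,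
    ExteriorAlgebra.contractList_map, h2]
  have h4 := ExteriorAlgebra.repr_map (dParam m) h3 Γ.cycleForm S
  rw [← ExteriorAlgebra.map_comp_map, AlgHom.comp_apply] at h4
  change _ • (dParam m).ExteriorAlgebra.repr ((ExteriorAlgebra.map (restrictParam n m))
    ((ExteriorAlgebra.map F) Γ.cycleForm)) S = _
  rw [h4, Finset.prod_mul_distrib, smul_eq_mul]
  change _ = _ * (dParam m).ExteriorAlgebra.repr Γ.cycleForm S * _
  ring

/-- A vector in the kernel of the edge map is a linear relation between the columns. -/
theorem cycleForm_eq_zero (h : ¬ Function.Injective Γ.edgeMap) : Γ.cycleForm = 0 := by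
  rw [← LinearMap.ker_eq_bot, Submodule.eq_bot_iff] at h
  push Not at h
  obtain ⟨c, hc, hc0⟩ := h
  refine ExteriorAlgebra.contractList_eq_zero_of_combination _ hc0 ?_
  have : ∑ v, c v • Γ.column v = Dual.eval ℝ _ (Γ.edgeMap c) := by
    conv_rhs => rw [← (Pi.basisFun ℝ (Fin n)).sum_repr c]
    simp [column]
  rw [this, LinearMap.mem_ker.mp hc]
  simp

end FeynmanGraph

end

/-! ### Gaussian integrals: convergence and integration by parts -/

noncomputable section

namespace FeynmanGraph

variable {n m : ℕ} (Γ : FeynmanGraph n m)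

theorem energy_nonneg {a : Fin m → ℝ} (ha : ∀ e, 0 < a e) (x : Fin n → ℝ) : 0 ≤ Γ.energy a x :=
  Finset.sum_nonneg fun e _ => div_nonneg (sq_nonneg _) (ha e).le

theorem sq_edgeMap_le {a : Fin m → ℝ} (ha : ∀ e, 0 < a e) (x : Fin n → ℝ) (e : Fin m) :
    Γ.edgeMap x e ^ 2 ≤ a e * Γ.energy a x := by
  have h := Finset.single_le_sum (f := fun e => Γ.edgeMap x e ^ 2 / a e)
    (fun e _ => div_nonneg (sq_nonneg _) (ha e).le) (Finset.mem_univ e)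
  rw [mul_comm]
  exact (div_le_iff₀ (ha e)).mp h

theorem exists_sum_sq_le_energy (hinj : Function.Injective Γ.edgeMap) {a : Fin m → ℝ}
    (ha : ∀ e, 0 < a e) : ∃ C > 0, ∀ x, ∑ v, x v ^ 2 ≤ C * Γ.energy a x := by
  obtain ⟨K, -, hK⟩ := Γ.edgeMap.exists_antilipschitzWith (LinearMap.ker_eq_bot.mpr hinj)
  have hA : 0 ≤ ∑ e, a e := Finset.sum_nonneg fun e _ => (ha e).le
  -- K is the constant of the lower bound for the injective edge map; the summand 1 only makes the
  -- constant positive.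
  refine ⟨n * (K ^ 2 * ∑ e, a e) + 1, by positivity, fun x => ?_⟩
  have hq := Γ.energy_nonneg ha x
  have h1 : ‖Γ.edgeMap x‖ ≤ √((∑ e, a e) * Γ.energy a x) := by
    refine (pi_norm_le_iff_of_nonneg (Real.sqrt_nonneg _)).mpr fun e => ?_
    rw [Real.norm_eq_abs]
    refine Real.abs_le_sqrt ((Γ.sq_edgeMap_le ha x e).trans ?_)
    gcongr
    exact Finset.single_le_sum (f := a) (fun e _ => (ha e).le) (Finset.mem_univ e)
  have h2 : ‖x‖ ^ 2 ≤ (K ^ 2 * ∑ e, a e) * Γ.energy a x := by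
    have h3 := hK.le_mul_norm (map_zero _) x
    calc ‖x‖ ^ 2 ≤ (K * √((∑ e, a e) * Γ.energy a x)) ^ 2 := by gcongr; exact h3.trans (by gcongr)
      _ = _ := by rw [mul_pow, Real.sq_sqrt (by positivity), mul_assoc]
  calc ∑ v, x v ^ 2 ≤ ∑ _v : Fin n, ‖x‖ ^ 2 := by
        refine Finset.sum_le_sum fun v _ => ?_
        rw [← sq_abs]
        gcongr
        exact norm_le_pi_norm x v
    _ = n * ‖x‖ ^ 2 := by simp
    _ ≤ n * ((K ^ 2 * ∑ e, a e) * Γ.energy a x) := by gcongr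
    _ ≤ _ := by nlinarith

theorem continuous_edgeMap : Continuous Γ.edgeMap := Γ.edgeMap.continuous_of_finiteDimensional

theorem continuous_edgeMap_apply (e : Fin m) : Continuous fun x => Γ.edgeMap x e :=
  (continuous_apply e).comp Γ.continuous_edgeMap

theorem continuous_energy (a : Fin m → ℝ) : Continuous (Γ.energy a) := by
  have := Γ.continuous_edgeMap_apply
  unfold energy
  fun_prop

theorem integrable_exp_neg_half_energy (hinj : Function.Injective Γ.edgeMap) {a : Fin m → ℝ}
    (ha : ∀ e, 0 < a e) : Integrable fun x => Real.exp (-(Γ.energy a x / 2)) := by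
  obtain ⟨C, hC, h⟩ := Γ.exists_sum_sq_le_energy hinj ha
  have hI : Integrable fun x : Fin n → ℝ => ∏ v, Real.exp (-(2 * C)⁻¹ * x v ^ 2) :=
    Integrable.fintype_prod fun _ => integrable_exp_neg_mul_sq (by positivity)
  have := Γ.continuous_energy a
  refine hI.mono' (by fun_prop) (Filter.Eventually.of_forall fun x => ?_)
  rw [Real.norm_eq_abs, Real.abs_exp, ← Real.exp_sum, Real.exp_le_exp, ← Finset.mul_sum]
  have h1 : (2 * C)⁻¹ * ∑ v, x v ^ 2 ≤ (2 * C)⁻¹ * (C * Γ.energy a x) := by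
    gcongr; exact h x
  have h2 : (2 * C)⁻¹ * (C * Γ.energy a x) = Γ.energy a x / 2 := by field_simp
  linarith

/-- With t = |x_e|/√a_e this is t ≤ 1 + t²/4 ≤ exp(t²/4). The exponent 1/4 lets two products over
edge sets together cost only half of the Gaussian weight. -/
theorem abs_edgeMap_le {a : Fin m → ℝ} (ha : ∀ e, 0 < a e) (x : Fin n → ℝ) (e : Fin m) :
    |Γ.edgeMap x e| ≤ √(a e) * Real.exp (Γ.edgeMap x e ^ 2 / a e / 4) := by
  have hs : 0 < √(a e) := Real.sqrt_pos.mpr (ha e)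
  have h1 := Real.add_one_le_exp (Γ.edgeMap x e ^ 2 / a e / 4)
  have h2 : |Γ.edgeMap x e| / √(a e) ≤ Γ.edgeMap x e ^ 2 / a e / 4 + 1 := by
    have : Γ.edgeMap x e ^ 2 / a e = (|Γ.edgeMap x e| / √(a e)) ^ 2 := by
      rw [div_pow, sq_abs, Real.sq_sqrt (ha e).le]
    rw [this]
    nlinarith [sq_nonneg (|Γ.edgeMap x e| / √(a e) - 2)]
  calc |Γ.edgeMap x e| = √(a e) * (|Γ.edgeMap x e| / √(a e)) := by field_simp
    _ ≤ _ := by gcongr; linarith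

theorem abs_prod_edgeMap_le {a : Fin m → ℝ} (ha : ∀ e, 0 < a e) (x : Fin n → ℝ)
    (S : Finset (Fin m)) :
    |∏ e ∈ S, Γ.edgeMap x e| ≤ (∏ e ∈ S, √(a e)) * Real.exp (Γ.energy a x / 4) := by
  rw [Finset.abs_prod]
  calc ∏ e ∈ S, |Γ.edgeMap x e|
      ≤ ∏ e ∈ S, (√(a e) * Real.exp (Γ.edgeMap x e ^ 2 / a e / 4)) :=
        Finset.prod_le_prod (fun _ _ => abs_nonneg _) fun e _ => Γ.abs_edgeMap_le ha x e
    _ = (∏ e ∈ S, √(a e)) * Real.exp (∑ e ∈ S, Γ.edgeMap x e ^ 2 / a e / 4) := by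
        rw [Finset.prod_mul_distrib, Real.exp_sum]
    _ ≤ _ := by
        gcongr
        rw [energy, Finset.sum_div]
        exact Finset.sum_le_sum_of_subset_of_nonneg (Finset.subset_univ _) fun e _ _ =>
          div_nonneg (div_nonneg (sq_nonneg _) (ha e).le) (by norm_num)

theorem integrable_prod_mul_prod (hinj : Function.Injective Γ.edgeMap) {a : Fin m → ℝ}
    (ha : ∀ e, 0 < a e) (S T : Finset (Fin m)) :
    Integrable fun x => (∏ e ∈ S, Γ.edgeMap x e) * (∏ e ∈ T, Γ.edgeMap x e) *
      Real.exp (-Γ.energy a x) := by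
  have h1 := Γ.continuous_energy a
  have h2 := Γ.continuous_edgeMap_apply
  refine ((Γ.integrable_exp_neg_half_energy hinj ha).const_mul
    ((∏ e ∈ S, √(a e)) * ∏ e ∈ T, √(a e))).mono' (by fun_prop)
    (Filter.Eventually.of_forall fun x => ?_)
  rw [Real.norm_eq_abs, abs_mul, abs_mul, Real.abs_exp]
  calc _ ≤ ((∏ e ∈ S, √(a e)) * Real.exp (Γ.energy a x / 4)) *
        ((∏ e ∈ T, √(a e)) * Real.exp (Γ.energy a x / 4)) * Real.exp (-Γ.energy a x) := by
        gcongr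
        · exact Γ.abs_prod_edgeMap_le ha x S
        · exact Γ.abs_prod_edgeMap_le ha x T
    _ = ((∏ e ∈ S, √(a e)) * ∏ e ∈ T, √(a e)) *
        (Real.exp (Γ.energy a x / 4) * Real.exp (Γ.energy a x / 4) *
          Real.exp (-Γ.energy a x)) := by ring
    _ = _ := by
        rw [← Real.exp_add, ← Real.exp_add]
        congr 2
        ring

theorem integrable_prod (hinj : Function.Injective Γ.edgeMap) {a : Fin m → ℝ}
    (ha : ∀ e, 0 < a e) (S : Finset (Fin m)) :
    Integrable fun x => (∏ e ∈ S, Γ.edgeMap x e) * Real.exp (-Γ.energy a x) := by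
  simpa using Γ.integrable_prod_mul_prod hinj ha ∅ S

theorem integrable_mul_prod (hinj : Function.Injective Γ.edgeMap) {a : Fin m → ℝ}
    (ha : ∀ e, 0 < a e) (f : Fin m) (S : Finset (Fin m)) :
    Integrable fun x => Γ.edgeMap x f * (∏ e ∈ S, Γ.edgeMap x e) * Real.exp (-Γ.energy a x) := by
  simpa using Γ.integrable_prod_mul_prod hinj ha {f} S

/-- Integration by parts against the constant function 1, for which only the products have to be
integrable. -/
theorem integral_eq_zero_of_hasLineDerivAt {g g' : (Fin n → ℝ) → ℝ} {v : Fin n → ℝ}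
    (hg : Integrable g) (hg' : Integrable g') (h : ∀ x, HasLineDerivAt ℝ g (g' x) x v) :
    ∫ x, g' x = 0 := by
  have := integral_bilinear_hasLineDerivAt_right_eq_neg_left_of_integrable
    (μ := (volume : Measure (Fin n → ℝ))) (f := fun _ => (1 : ℝ)) (f' := fun _ => 0) (g := g)
    (g' := g') (v := v) (B := ContinuousLinearMap.mul ℝ ℝ) (by simp) (by simpa using hg')
    (by simpa using hg) (fun x _ => hasDerivAt_const _ _) (fun x _ => h x)
  simpa using this

/-- Integration by parts against the Gaussian weight. -/
theorem sum_integral_mul_prod (hinj : Function.Injective Γ.edgeMap) {a : Fin m → ℝ}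
    (ha : ∀ e, 0 < a e) (S : Finset (Fin m)) (v : Fin n → ℝ) :
    ∑ f, (2 / a f * Γ.edgeMap v f) *
        ∫ x, Γ.edgeMap x f * (∏ e ∈ S, Γ.edgeMap x e) * Real.exp (-Γ.energy a x) =
      ∑ e ∈ S, Γ.edgeMap v e *
        ∫ x, (∏ i ∈ S.erase e, Γ.edgeMap x i) * Real.exp (-Γ.energy a x) := by
  have hI1 := fun e => (Γ.integrable_prod hinj ha (S.erase e)).const_mul (Γ.edgeMap v e)
  have hI2 := fun f => (Γ.integrable_mul_prod hinj ha f S).const_mul (2 / a f * Γ.edgeMap v f)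
  -- The derivative along `v` either removes one factor x_e or brings down the derivative of the
  -- energy.
  have key := integral_eq_zero_of_hasLineDerivAt (v := v)
    (g := fun x => (∏ e ∈ S, Γ.edgeMap x e) * Real.exp (-Γ.energy a x))
    (g' := fun x => (∑ e ∈ S, Γ.edgeMap v e *
        ((∏ i ∈ S.erase e, Γ.edgeMap x i) * Real.exp (-Γ.energy a x))) -
      ∑ f, (2 / a f * Γ.edgeMap v f) *
        (Γ.edgeMap x f * (∏ e ∈ S, Γ.edgeMap x e) * Real.exp (-Γ.energy a x)))
    (Γ.integrable_prod hinj ha S)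
    ((integrable_finsetSum _ fun e _ => hI1 e).sub (integrable_finsetSum _ fun f _ => hI2 f))
    (fun x => ?_)
  · rw [integral_sub (integrable_finsetSum _ fun e _ => hI1 e)
      (integrable_finsetSum _ fun f _ => hI2 f), integral_finsetSum _ fun e _ => hI1 e,
      integral_finsetSum _ fun f _ => hI2 f, sub_eq_zero] at key
    simp only [integral_const_mul] at key
    exact key.symm
  · have hl : ∀ e, HasDerivAt (fun t : ℝ => Γ.edgeMap (x + t • v) e) (Γ.edgeMap v e) 0 := by
      intro e
      have h := ((hasDerivAt_id (0 : ℝ)).mul_const (Γ.edgeMap v e)).const_add (Γ.edgeMap x e)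
      simpa using h
    have hE : HasDerivAt (fun t : ℝ => Γ.energy a (x + t • v))
        (∑ f, 2 * Γ.edgeMap x f * Γ.edgeMap v f / a f) 0 := by
      unfold energy
      refine HasDerivAt.fun_sum fun f _ => ?_
      simpa using ((hl f).pow 2).div_const (a f)
    have hP := HasDerivAt.fun_finsetProd (u := S) fun e _ => hl e
    have hT := hP.mul hE.neg.exp
    unfold HasLineDerivAt
    convert! hT using 1
    simp only [zero_smul, add_zero, smul_eq_mul, Finset.sum_mul, mul_neg, Finset.mul_sum,
      Pi.neg_apply, sub_eq_add_neg]
    congr 1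
    · exact Finset.sum_congr rfl fun e _ => by ring
    · congr 1
      exact Finset.sum_congr rfl fun f _ => by ring

end FeynmanGraph

end

/-! ### Form-valued Gaussian expectations -/

noncomputable section

namespace FeynmanGraph

open CliffordAlgebra (involute contractRight)
open ExteriorAlgebra (contractList ι)

variable {n m : ℕ} (Γ : FeynmanGraph n m)

/-- The algebra of forms at a point of the space of Schwinger parameters. -/
abbrev ParamForms (m : ℕ) : Type := ExteriorAlgebra ℝ (Dual ℝ (Fin m → ℝ))

/-- The Gaussian integral of a form-valued function of the positions, coefficient by coefficient. -/
def gaussInt (a : Fin m → ℝ) (F : (Fin n → ℝ) → ParamForms m) : ParamForms m :=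
  ∑ S, (∫ x, (edgeForms m).repr (F x) S * Real.exp (-Γ.energy a x)) • edgeForms m S

/-- All coefficients are integrable against the Gaussian weight. -/
def GaussIntegrable (a : Fin m → ℝ) (F : (Fin n → ℝ) → ParamForms m) : Prop :=
  ∀ S, Integrable fun x => (edgeForms m).repr (F x) S * Real.exp (-Γ.energy a x)

theorem repr_gaussInt (a : Fin m → ℝ) (F : (Fin n → ℝ) → ParamForms m) (S : Finset (Fin m)) :
    (edgeForms m).repr (Γ.gaussInt a F) S =
      ∫ x, (edgeForms m).repr (F x) S * Real.exp (-Γ.energy a x) := by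
  rw [gaussInt, Basis.repr_sum_self]

variable {Γ}

theorem gaussInt_linearMap {a : Fin m → ℝ} {F : (Fin n → ℝ) → ParamForms m}
    (hF : Γ.GaussIntegrable a F) (T : ParamForms m →ₗ[ℝ] ParamForms m) :
    Γ.gaussInt a (fun x => T (F x)) = T (Γ.gaussInt a F) := by
  refine (edgeForms m).ext_elem fun S => ?_
  rw [repr_gaussInt, gaussInt, map_sum, map_sum, Finsupp.finsetSum_apply]
  have h : ∀ x, (edgeForms m).repr (T (F x)) S * Real.exp (-Γ.energy a x) =
      ∑ S', (edgeForms m).repr (T (edgeForms m S')) S *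
        ((edgeForms m).repr (F x) S' * Real.exp (-Γ.energy a x)) := by
    intro x
    conv_lhs => rw [← (edgeForms m).sum_repr (F x)]
    simp only [map_sum, map_smul, Finsupp.finsetSum_apply, Finsupp.smul_apply, smul_eq_mul,
      Finset.sum_mul]
    exact Finset.sum_congr rfl fun S' _ => by ring
  simp only [h]
  rw [integral_finsetSum _ fun S' _ => (hF S').const_mul _]
  refine Finset.sum_congr rfl fun S' _ => ?_
  rw [integral_const_mul, map_smul, map_smul, Finsupp.smul_apply, smul_eq_mul, mul_comm]

variable (Γ)

/-- The linear map `da_e ↦ x_e da_e`. -/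
def scaleEdges (x : Fin n → ℝ) : Dual ℝ (Fin m → ℝ) →ₗ[ℝ] Dual ℝ (Fin m → ℝ) :=
  (dParam m).constr ℝ fun e => Γ.edgeMap x e • dParam m e

theorem scaleEdges_dParam (x : Fin n → ℝ) (e : Fin m) :
    Γ.scaleEdges x (dParam m e) = Γ.edgeMap x e • dParam m e := by
  rw [scaleEdges, Basis.constr_basis]

theorem coord_comp_scaleEdges (x : Fin n → ℝ) (e : Fin m) :
    (dParam m).coord e ∘ₗ Γ.scaleEdges x = Γ.edgeMap x e • (dParam m).coord e := by
  refine (dParam m).ext fun f => ?_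
  rw [LinearMap.comp_apply, scaleEdges_dParam, map_smul, LinearMap.smul_apply, Basis.coord_apply,
    Basis.repr_self, smul_eq_mul, smul_eq_mul]
  by_cases h : f = e
  · rw [h]
  · rw [Finsupp.single_eq_of_ne (Ne.symm h), mul_zero, mul_zero]

theorem repr_map_scaleEdges (x : Fin n → ℝ) (W : ParamForms m) (S : Finset (Fin m)) :
    (edgeForms m).repr (ExteriorAlgebra.map (Γ.scaleEdges x) W) S =
      (∏ e ∈ S, Γ.edgeMap x e) * (edgeForms m).repr W S :=
  ExteriorAlgebra.repr_map (dParam m) (Γ.scaleEdges_dParam x) W S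

/-- The Gaussian expectation of the multivector `W`, with `da_e` replaced by `x_e da_e`. -/
def gaussForm (a : Fin m → ℝ) (W : ParamForms m) : ParamForms m :=
  Γ.gaussInt a fun x => ExteriorAlgebra.map (Γ.scaleEdges x) W

/-- As `gaussForm`, with an additional factor `x_f`. -/
def gaussForm₁ (a : Fin m → ℝ) (f : Fin m) (W : ParamForms m) : ParamForms m :=
  Γ.gaussInt a fun x => Γ.edgeMap x f • ExteriorAlgebra.map (Γ.scaleEdges x) W

theorem repr_gaussForm (a : Fin m → ℝ) (W : ParamForms m) (S : Finset (Fin m)) :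
    (edgeForms m).repr (Γ.gaussForm a W) S = (edgeForms m).repr W S *
      ∫ x, (∏ e ∈ S, Γ.edgeMap x e) * Real.exp (-Γ.energy a x) := by
  rw [gaussForm, repr_gaussInt, ← integral_const_mul]
  congr 1
  ext x
  rw [repr_map_scaleEdges]
  ring

theorem repr_gaussForm₁ (a : Fin m → ℝ) (f : Fin m) (W : ParamForms m) (S : Finset (Fin m)) :
    (edgeForms m).repr (Γ.gaussForm₁ a f W) S = (edgeForms m).repr W S *
      ∫ x, Γ.edgeMap x f * (∏ e ∈ S, Γ.edgeMap x e) * Real.exp (-Γ.energy a x) := by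
  rw [gaussForm₁, repr_gaussInt, ← integral_const_mul]
  congr 1
  ext x
  rw [map_smul, Finsupp.smul_apply, repr_map_scaleEdges, smul_eq_mul]
  ring

/-- `gaussForm` as a linear map. -/
def gaussFormHom (a : Fin m → ℝ) : ParamForms m →ₗ[ℝ] ParamForms m where
  toFun := Γ.gaussForm a
  map_add' W W' := (edgeForms m).ext_elem fun S => by simp [repr_gaussForm, add_mul]
  map_smul' c W := (edgeForms m).ext_elem fun S => by simp [repr_gaussForm, mul_assoc]

theorem gaussFormHom_apply (a : Fin m → ℝ) (W : ParamForms m) :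
    Γ.gaussFormHom a W = Γ.gaussForm a W := rfl

variable {Γ}

theorem gaussIntegrable_map (hinj : Function.Injective Γ.edgeMap) {a : Fin m → ℝ}
    (ha : ∀ e, 0 < a e) (W : ParamForms m) :
    Γ.GaussIntegrable a fun x => ExteriorAlgebra.map (Γ.scaleEdges x) W := by
  intro S
  refine ((Γ.integrable_prod hinj ha S).const_mul ((edgeForms m).repr W S)).congr
    (Filter.Eventually.of_forall fun x => ?_)
  simp only [repr_map_scaleEdges]
  ring

theorem gaussIntegrable_smul_map (hinj : Function.Injective Γ.edgeMap) {a : Fin m → ℝ}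
    (ha : ∀ e, 0 < a e) (f : Fin m) (W : ParamForms m) :
    Γ.GaussIntegrable a fun x => Γ.edgeMap x f • ExteriorAlgebra.map (Γ.scaleEdges x) W := by
  intro S
  refine ((Γ.integrable_mul_prod hinj ha f S).const_mul ((edgeForms m).repr W S)).congr
    (Filter.Eventually.of_forall fun x => ?_)
  simp only [map_smul, Finsupp.smul_apply, repr_map_scaleEdges, smul_eq_mul]
  ring

/-- Contracting x_e da_e instead of da_e produces the extra factor x_e. -/
theorem contractRight_gaussForm (hinj : Function.Injective Γ.edgeMap) {a : Fin m → ℝ}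
    (ha : ∀ e, 0 < a e) (W : ParamForms m) (e : Fin m) :
    contractRight (Γ.gaussForm a W) ((dParam m).coord e) =
      Γ.gaussForm₁ a e (contractRight W ((dParam m).coord e)) := by
  rw [gaussForm, gaussForm₁]
  refine (gaussInt_linearMap (gaussIntegrable_map hinj ha W)
    (contractRight.flip ((dParam m).coord e))).symm.trans ?_
  congr 1
  ext1 x
  rw [LinearMap.flip_apply, ExteriorAlgebra.contractRight_map, coord_comp_scaleEdges, map_smul,
    map_smul]

theorem gaussForm_mul_ι (hinj : Function.Injective Γ.edgeMap) {a : Fin m → ℝ}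
    (ha : ∀ e, 0 < a e) (W : ParamForms m) (f : Fin m) :
    Γ.gaussForm a (W * ι ℝ (dParam m f)) = Γ.gaussForm₁ a f W * ι ℝ (dParam m f) := by
  rw [gaussForm, gaussForm₁]
  refine Eq.trans ?_ (gaussInt_linearMap (gaussIntegrable_smul_map hinj ha f W)
    (LinearMap.mulRight ℝ (ι ℝ (dParam m f))))
  congr 1
  ext1 x
  rw [LinearMap.mulRight_apply, map_mul, ExteriorAlgebra.map_apply_ι, scaleEdges_dParam, map_smul,
    mul_smul_comm, smul_mul_assoc]

theorem involute_gaussForm (hinj : Function.Injective Γ.edgeMap) {a : Fin m → ℝ}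
    (ha : ∀ e, 0 < a e) (W : ParamForms m) :
    involute (Γ.gaussForm a W) = Γ.gaussForm a (involute W) := by
  rw [gaussForm, gaussForm]
  refine (gaussInt_linearMap (gaussIntegrable_map hinj ha W) involute.toLinearMap).symm.trans ?_
  congr 1
  ext1 x
  exact ExteriorAlgebra.involute_map _ _

/-- Monomials that contain da_e die in the product, so the eigenvalue at `e` is irrelevant. -/
theorem map_mul_ι_congr {f g : Dual ℝ (Fin m → ℝ) →ₗ[ℝ] Dual ℝ (Fin m → ℝ)} {c d : Fin m → ℝ}
    (hf : ∀ i, f (dParam m i) = c i • dParam m i) (hg : ∀ i, g (dParam m i) = d i • dParam m i)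
    (e : Fin m) (h : ∀ i ≠ e, c i = d i) (Z : ParamForms m) :
    ExteriorAlgebra.map f Z * ι ℝ (dParam m e) = ExteriorAlgebra.map g Z * ι ℝ (dParam m e) := by
  suffices H : LinearMap.mulRight ℝ (ι ℝ (dParam m e)) ∘ₗ (ExteriorAlgebra.map f).toLinearMap =
      LinearMap.mulRight ℝ (ι ℝ (dParam m e)) ∘ₗ (ExteriorAlgebra.map g).toLinearMap from
    LinearMap.congr_fun H Z
  refine (edgeForms m).ext fun S => ?_
  simp only [LinearMap.comp_apply, AlgHom.toLinearMap_apply, LinearMap.mulRight_apply, edgeForms]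
  rw [ExteriorAlgebra.map_basis _ hf, ExteriorAlgebra.map_basis _ hg, smul_mul_assoc,
    smul_mul_assoc]
  by_cases he : e ∈ S
  · rw [ExteriorAlgebra.basis_mul_ι_of_mem _ he, smul_zero, smul_zero]
  · rw [Finset.prod_congr rfl fun i hi => h i (by rintro rfl; exact he hi)]

/-- The contraction removes da_e before the scaling and the product restores it afterwards, so the
factor x_e is missing. This matches the terms with one factor removed in `sum_integral_mul_prod`. -/
theorem repr_gaussForm_contractRight_mul_ι (hinj : Function.Injective Γ.edgeMap) {a : Fin m → ℝ}
    (ha : ∀ e, 0 < a e) (W : ParamForms m) (e : Fin m) (S : Finset (Fin m)) :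
    (edgeForms m).repr (Γ.gaussForm a (contractRight W ((dParam m).coord e)) *
        ι ℝ (dParam m e)) S =
      if e ∈ S then (edgeForms m).repr W S *
        ∫ x, (∏ i ∈ S.erase e, Γ.edgeMap x i) * Real.exp (-Γ.energy a x) else 0 := by
  have h1 := gaussInt_linearMap (gaussIntegrable_map hinj ha (contractRight W ((dParam m).coord e)))
    (LinearMap.mulRight ℝ (ι ℝ (dParam m e)))
  rw [LinearMap.mulRight_apply] at h1
  change _ = Γ.gaussForm a _ * _ at h1
  rw [← h1, repr_gaussInt]
  have h2 : ∀ x, (edgeForms m).repr (LinearMap.mulRight ℝ (ι ℝ (dParam m e))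
      (ExteriorAlgebra.map (Γ.scaleEdges x) (contractRight W ((dParam m).coord e)))) S =
      if e ∈ S then (edgeForms m).repr W S * ∏ i ∈ S.erase e, Γ.edgeMap x i else 0 := by
    intro x
    -- With eigenvalue 1 at `e` the map fixes da_e, so the multiplication can be carried out before
    -- it.
    set g : Dual ℝ (Fin m → ℝ) →ₗ[ℝ] Dual ℝ (Fin m → ℝ) := (dParam m).constr ℝ fun i =>
      Function.update (Γ.edgeMap x) e 1 i • dParam m i with hg
    have hg' : ∀ i, g (dParam m i) = Function.update (Γ.edgeMap x) e 1 i • dParam m i := fun i => by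
      rw [hg, Basis.constr_basis]
    rw [LinearMap.mulRight_apply, map_mul_ι_congr (Γ.scaleEdges_dParam x) hg' e
      fun i hi => by rw [Function.update_of_ne hi]]
    have h3 : ExteriorAlgebra.map g (contractRight W ((dParam m).coord e)) * ι ℝ (dParam m e) =
        ExteriorAlgebra.map g (contractRight W ((dParam m).coord e) * ι ℝ (dParam m e)) := by
      rw [map_mul, ExteriorAlgebra.map_apply_ι, hg', Function.update_self, one_smul]
    rw [h3, edgeForms, ExteriorAlgebra.repr_map (dParam m) hg',
      ExteriorAlgebra.repr_contractRight_mul_ι]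
    split_ifs with he
    · rw [← Finset.mul_prod_erase _ _ he, Function.update_self, one_mul, mul_comm]
      congr 1
      exact Finset.prod_congr rfl fun i hi => Function.update_of_ne (Finset.ne_of_mem_erase hi) _ _
    · rw [mul_zero]
  simp only [h2]
  split_ifs with he
  · rw [← integral_const_mul]
    simp only [mul_assoc]
  · simp

/-- Integration by parts for form-valued Gaussian expectations. -/
theorem sum_smul_gaussForm₁ (hinj : Function.Injective Γ.edgeMap) {a : Fin m → ℝ}
    (ha : ∀ e, 0 < a e) (W : ParamForms m) (v : Fin n → ℝ) :
    ∑ f, (2 / a f * Γ.edgeMap v f) • Γ.gaussForm₁ a f W =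
      ∑ e, Γ.edgeMap v e • (Γ.gaussForm a (contractRight W ((dParam m).coord e)) *
        ι ℝ (dParam m e)) := by
  refine (edgeForms m).ext_elem fun S => ?_
  simp only [map_sum, map_smul, Finsupp.finsetSum_apply, Finsupp.smul_apply, repr_gaussForm₁,
    repr_gaussForm_contractRight_mul_ι hinj ha, smul_eq_mul, mul_ite, mul_zero]
  rw [Finset.sum_ite_mem, Finset.univ_inter]
  calc _ = (edgeForms m).repr W S * ∑ f, (2 / a f * Γ.edgeMap v f) *
        ∫ x, Γ.edgeMap x f * (∏ e ∈ S, Γ.edgeMap x e) * Real.exp (-Γ.energy a x) := by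
        rw [Finset.mul_sum]
        exact Finset.sum_congr rfl fun f _ => by ring
    _ = _ := by
        rw [Γ.sum_integral_mul_prod hinj ha S v, Finset.mul_sum]
        exact Finset.sum_congr rfl fun f _ => by ring

end FeynmanGraph

end

/-! ### Degree and scalar part -/

namespace ExteriorAlgebra

open CliffordAlgebra (involute contractRight)

variable {R M N : Type*} [CommRing R] [AddCommGroup M] [Module R M] [AddCommGroup N] [Module R N]

theorem algebraMapInv_map (f : M →ₗ[R] N) (x : ExteriorAlgebra R M) :
    algebraMapInv (map f x) = algebraMapInv x := by
  induction x using ExteriorAlgebra.induction with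
  | algebraMap r => simp
  | ι w => simp [algebraMapInv]
  | mul a b ha hb => simp only [map_mul, ha, hb]
  | add a b ha hb => simp only [map_add, ha, hb]

theorem algebraMapInv_eq_repr {I : Type*} [LinearOrder I] [Fintype I] (b : Basis I R M)
    (x : ExteriorAlgebra R M) : algebraMapInv x = b.ExteriorAlgebra.repr x ∅ := by
  conv_lhs => rw [← b.ExteriorAlgebra.sum_repr x]
  simp only [map_sum, map_smul, algebraMapInv_basis]
  simp

theorem contractList_map_smul (l : List (Dual R M)) (c : R) (x : ExteriorAlgebra R M) :
    contractList (l.map fun d => c • d) x = c ^ l.length • contractList l x := by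
  induction l with
  | nil => simp
  | cons d l ih => simp [ih, pow_succ, mul_smul, smul_comm c]

theorem map_smul_id_ιMulti {n : ℕ} (c : R) (v : Fin n → M) :
    map (c • LinearMap.id) (ιMulti R n v) = c ^ n • ιMulti R n v := by
  rw [map_apply_ιMulti]
  have : (c • LinearMap.id : M →ₗ[R] M) ∘ v = fun i => c • v i := rfl
  rw [this]
  simpa using (ιMulti R n (M := M)).map_smul_univ (fun _ => c) v

/-- Homogeneity: doubling all vectors multiplies the scalar part by 2^n, while doubling the
functionals instead multiplies it by 2 to the length of the list. -/
theorem algebraMapInv_contractList_ιMulti_eq_zero [IsDomain R] [CharZero R] {n : ℕ}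
    {l : List (Dual R M)} (h : l.length ≠ n) (v : Fin n → M) :
    algebraMapInv (contractList l (ιMulti R n v)) = 0 := by
  have h1 := contractList_map (2 • LinearMap.id : M →ₗ[R] M) l (ιMulti R n v)
  have h2 : (l.map fun d => d ∘ₗ (2 • LinearMap.id : M →ₗ[R] M)) = l.map fun d => (2 : R) • d := by
    refine List.map_congr_left fun d _ => ?_
    ext x; simp
  have h3 : (2 • LinearMap.id : M →ₗ[R] M) = (2 : R) • LinearMap.id := by
    ext x; simp [two_smul]
  rw [h2, contractList_map_smul, h3, map_smul_id_ιMulti, contractList_smul] at h1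
  have h4 := congrArg algebraMapInv h1
  rw [map_smul, map_smul, map_smul, algebraMapInv_map, smul_eq_mul, smul_eq_mul] at h4
  have h5 : ((2 : R) ^ n - 2 ^ l.length) * algebraMapInv (contractList l (ιMulti R n v)) = 0 := by
    rw [sub_mul, h4, sub_self]
  refine (mul_eq_zero.mp h5).resolve_left fun h6 => h ?_
  have h7 : ((2 ^ n : ℕ) : R) = ((2 ^ l.length : ℕ) : R) := by
    push_cast; exact sub_eq_zero.mp h6
  exact (Nat.pow_right_injective le_rfl (Nat.cast_injective h7)).symm

theorem involute_ιMulti {n : ℕ} (v : Fin n → M) :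
    involute (ιMulti R n v) = (-1 : R) ^ n • ιMulti R n v := by
  have := CliffordAlgebra.involute_prod_map_ι (Q := (0 : QuadraticForm R M)) (List.ofFn v)
  rwa [List.map_ofFn, List.length_ofFn] at this

instance {K V : Type*} [Field K] [CharZero K] [AddCommGroup V] [Module K V] :
    IsAddTorsionFree (ExteriorAlgebra K V) :=
  Module.isTorsionFree_int_iff_isAddTorsionFree.mp (Module.IsTorsionFree.trans_faithfulSMul ℤ K _)

end ExteriorAlgebra

/-! ### The vanishing of α∧α -/

noncomputable section

namespace FeynmanGraph

open CliffordAlgebra (involute contractRight)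
open ExteriorAlgebra (contractList ι)

variable {n m : ℕ} {Γ : FeynmanGraph n m}

theorem involute_gaussForm₁ (hinj : Function.Injective Γ.edgeMap) {a : Fin m → ℝ}
    (ha : ∀ e, 0 < a e) (f : Fin m) (W : ParamForms m) :
    involute (Γ.gaussForm₁ a f W) = Γ.gaussForm₁ a f (involute W) := by
  rw [gaussForm₁, gaussForm₁]
  refine (gaussInt_linearMap (gaussIntegrable_smul_map hinj ha f W)
    involute.toLinearMap).symm.trans ?_
  congr 1
  ext1 x
  rw [map_smul]
  exact congrArg _ (ExteriorAlgebra.involute_map _ _)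

theorem gaussForm₁_neg (a : Fin m → ℝ) (f : Fin m) (W : ParamForms m) :
    Γ.gaussForm₁ a f (-W) = -Γ.gaussForm₁ a f W :=
  (edgeForms m).ext_elem fun S => by simp [repr_gaussForm₁]

theorem column_dParam (v : Fin n) (e : Fin m) :
    Γ.column v (dParam m e) = Γ.edgeMap (Pi.single v 1) e := by
  simp [column]

variable (Γ) in
theorem involute_cycleForm : involute Γ.cycleForm = (-1 : ℝ) ^ (n + m) • Γ.cycleForm := by
  rw [cycleForm, ExteriorAlgebra.involute_contractList, edgeForms_univ,
    ExteriorAlgebra.involute_ιMulti, ExteriorAlgebra.contractList_smul, smul_smul, pow_add,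
    List.length_ofFn]

variable (Γ) in
-- Identity (a). The top form times da_f is zero, so the cycle form times da_f is a combination of
-- forms weighted by row f of the incidence matrix; contract this with e.
theorem exists_contractRight_cycleForm_mul_ι (e : Fin m) :
    ∃ U : Fin n → ParamForms m, ∀ f, ∑ v, Γ.edgeMap (Pi.single v 1) f • U v =
      (if f = e then Γ.cycleForm else 0) -
        contractRight Γ.cycleForm ((dParam m).coord e) * ι ℝ (dParam m f) := by
  obtain ⟨U, hU⟩ := ExteriorAlgebra.exists_contractList_mul_ι Γ.column (edgeForms m Finset.univ)
  refine ⟨fun v => contractRight (U v) ((dParam m).coord e), fun f => ?_⟩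
  have h1 := hU (dParam m f) (ExteriorAlgebra.basis_mul_ι_of_mem _ (Finset.mem_univ _))
  have h2 := CliffordAlgebra.contractRight_mul_ι ((dParam m).coord e) (dParam m f) Γ.cycleForm
  change Γ.cycleForm * _ = _ at h1
  rw [h1] at h2
  simp only [map_sum, map_smul, LinearMap.sum_apply, LinearMap.smul_apply, column_dParam] at h2
  rw [h2, Basis.coord_apply, Basis.repr_self, Finsupp.single_apply, ite_smul, one_smul, zero_smul]

/-- The coefficients of `da_e` in the Gaussian expectation of the cycle form annihilate it. -/
theorem gaussForm_mul_contractRight (hinj : Function.Injective Γ.edgeMap) {a : Fin m → ℝ}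
    (ha : ∀ e, 0 < a e) (hL : Even (n + m)) (e : Fin m) :
    Γ.gaussForm a Γ.cycleForm *
      contractRight (Γ.gaussForm a Γ.cycleForm) ((dParam m).coord e) = 0 := by
  obtain ⟨U, hU⟩ := Γ.exists_contractRight_cycleForm_mul_ι e
  set W := contractRight Γ.cycleForm ((dParam m).coord e) with hW
  set A := Γ.gaussForm a Γ.cycleForm with hA
  -- The cycle form is even, and the contraction changes the parity.
  have hodd : ∀ f, involute (Γ.gaussForm₁ a f W) = -Γ.gaussForm₁ a f W := fun f => by
    rw [involute_gaussForm₁ hinj ha, hW, ExteriorAlgebra.involute_contractRight,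
      involute_cycleForm, hL.neg_one_pow, one_smul, gaussForm₁_neg]
  have hV : ∀ f, ∑ v, Γ.edgeMap (Pi.single v 1) f • Γ.gaussForm a (U v) =
      (if f = e then A else 0) - Γ.gaussForm₁ a f W * ι ℝ (dParam m f) := fun f => by
    have h := congrArg (Γ.gaussFormHom a) (hU f)
    rw [map_sum, map_sub] at h
    simp only [map_smul, gaussFormHom_apply, gaussForm_mul_ι hinj ha] at h
    rw [h, hA]
    split_ifs
    · rfl
    · rw [← gaussFormHom_apply, map_zero]
  -- Integration by parts along each vertex direction, weighted with the integrals of `U v`; `hV`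
  -- then evaluates both sides.
  have hsum : ∑ v, Γ.gaussForm a (U v) *
        ∑ f, (2 / a f * Γ.edgeMap (Pi.single v 1) f) • Γ.gaussForm₁ a f W =
      ∑ v, Γ.gaussForm a (U v) * ∑ f, Γ.edgeMap (Pi.single v 1) f •
        (Γ.gaussForm a (contractRight W ((dParam m).coord f)) * ι ℝ (dParam m f)) :=
    Finset.sum_congr rfl fun v _ => by rw [sum_smul_gaussForm₁ hinj ha]
  -- Only f = e survives: the other contributions have the form X∧da_f∧X with X odd.
  have hleft : ∑ v, Γ.gaussForm a (U v) *
        ∑ f, (2 / a f * Γ.edgeMap (Pi.single v 1) f) • Γ.gaussForm₁ a f W =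
      (2 / a e) • (A * Γ.gaussForm₁ a e W) := by
    calc _ = ∑ f, (2 / a f) • ((∑ v, Γ.edgeMap (Pi.single v 1) f • Γ.gaussForm a (U v)) *
          Γ.gaussForm₁ a f W) := by
          simp only [Finset.mul_sum, Finset.sum_mul, Finset.smul_sum]
          rw [Finset.sum_comm]
          simp only [mul_smul_comm, smul_mul_assoc, smul_smul]
      _ = ∑ f, if f = e then (2 / a f) • (A * Γ.gaussForm₁ a f W) else 0 := by
          refine Finset.sum_congr rfl fun f _ => ?_
          rw [hV, sub_mul, ExteriorAlgebra.odd_mul_ι_mul_self (hodd f), sub_zero]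
          split_ifs <;> simp
      _ = _ := by rw [Finset.sum_ite_eq' Finset.univ e, if_pos (Finset.mem_univ _)]
  -- One contribution contains da_f twice, the other, at f = e, the double contraction with e.
  have hright : ∑ v, Γ.gaussForm a (U v) * ∑ f, Γ.edgeMap (Pi.single v 1) f •
        (Γ.gaussForm a (contractRight W ((dParam m).coord f)) * ι ℝ (dParam m f)) = 0 := by
    calc _ = ∑ f, (∑ v, Γ.edgeMap (Pi.single v 1) f • Γ.gaussForm a (U v)) *
          (Γ.gaussForm a (contractRight W ((dParam m).coord f)) * ι ℝ (dParam m f)) := by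
          simp only [Finset.mul_sum, Finset.sum_mul]
          rw [Finset.sum_comm]
          simp only [mul_smul_comm, smul_mul_assoc]
      _ = 0 := by
          refine Finset.sum_eq_zero fun f _ => ?_
          rw [hV, sub_mul, mul_assoc (Γ.gaussForm₁ a f W), ← mul_assoc (ι ℝ (dParam m f)),
            ExteriorAlgebra.ι_mul_mul_ι, mul_zero, sub_zero]
          split_ifs with h
          · subst h
            rw [hW, CliffordAlgebra.contractRight_contractRight, ← gaussFormHom_apply, map_zero,
              zero_mul, mul_zero]
          · rw [zero_mul]
  rw [hleft, hright] at hsum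
  rw [contractRight_gaussForm hinj ha]
  exact (smul_eq_zero.mp hsum).resolve_left (div_pos two_pos (ha e)).ne'

theorem gaussForm_cycleForm_mul_self (hinj : Function.Injective Γ.edgeMap) {a : Fin m → ℝ}
    (ha : ∀ e, 0 < a e) (hmn : n ≠ m) :
    Γ.gaussForm a Γ.cycleForm * Γ.gaussForm a Γ.cycleForm = 0 := by
  have hinv : involute (Γ.gaussForm a Γ.cycleForm) =
      (-1 : ℝ) ^ (n + m) • Γ.gaussForm a Γ.cycleForm := by
    rw [involute_gaussForm hinj ha, involute_cycleForm, ← gaussFormHom_apply, map_smul]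
    rfl
  rcases Nat.even_or_odd (n + m) with hL | hL
  · rw [hL.neg_one_pow, one_smul] at hinv
    refine ExteriorAlgebra.eq_zero_of_contractRight_eq_zero (dParam m) (fun e => ?_) ?_
    · have h := gaussForm_mul_contractRight hinj ha hL e
      rw [ExteriorAlgebra.contractRight_mul, hinv, ← ExteriorAlgebra.mul_comm_of_even hinv, h,
        add_zero]
    -- Contracting the top form of degree m with n ≠ m functionals leaves no constant term.
    · have h0 : ExteriorAlgebra.algebraMapInv Γ.cycleForm = 0 := by
        rw [cycleForm, edgeForms_univ]
        exact ExteriorAlgebra.algebraMapInv_contractList_ιMulti_eq_zero (by simpa using hmn) _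
      rw [ExteriorAlgebra.algebraMapInv_eq_repr (dParam m)] at h0
      rw [map_mul, ExteriorAlgebra.algebraMapInv_eq_repr (dParam m)]
      have h1 := Γ.repr_gaussForm a Γ.cycleForm ∅
      rw [edgeForms, h0, zero_mul] at h1
      rw [h1, zero_mul]
  · rw [hL.neg_one_pow, neg_one_smul] at hinv
    exact ExteriorAlgebra.mul_self_eq_zero_of_odd hinv

variable (Γ)

theorem alpha_eq {a : Fin m → ℝ} (ha : ∀ e, 0 < a e) :
    Γ.alpha a = (∏ e, (√(a e))⁻¹) • ExteriorAlgebra.map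
      ((dParam m).constr ℝ fun e => (-(2 * a e)⁻¹) • dParam m e)
      (Γ.gaussForm a Γ.cycleForm) := by
  refine (edgeForms m).ext_elem fun S => ?_
  have h1 := ExteriorAlgebra.repr_map (dParam m)
    (f := (dParam m).constr ℝ fun e => (-(2 * a e)⁻¹) • dParam m e) (c := fun e => -(2 * a e)⁻¹)
    (fun e => by rw [Basis.constr_basis]) (Γ.gaussForm a Γ.cycleForm) S
  have h2 := Γ.repr_gaussForm a Γ.cycleForm S
  rw [alpha, Basis.repr_sum_self, map_smul, Finsupp.smul_apply, smul_eq_mul]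
  simp only [Γ.fiberCoeff_eq ha]
  rw [edgeForms] at h2 ⊢
  rw [h1, h2, integral_const_mul]
  ring

theorem integrable_fiberCoeff {a : Fin m → ℝ} (ha : ∀ e, 0 < a e) (S : Finset (Fin m)) :
    Integrable (Γ.fiberCoeff a S) := by
  rw [funext (Γ.fiberCoeff_eq ha S)]
  by_cases hinj : Function.Injective Γ.edgeMap
  · exact (Γ.integrable_prod hinj ha S).const_mul _
  · simp [Γ.cycleForm_eq_zero hinj]

/-- The indicator function of a component that misses v_⋆ would be a nonzero kernel vector. -/
theorem isConnected_of_injective (hinj : Function.Injective Γ.edgeMap) : Γ.IsConnected := by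
  classical
  rw [IsConnected, SimpleGraph.connected_iff_exists_forall_reachable]
  refine ⟨Fin.last n, fun u => ?_⟩
  by_contra hu
  set G := Γ.toSimpleGraph Set.univ with hG
  have hu' : ¬ G.Reachable u (Fin.last n) := fun h => hu h.symm
  set c : Fin n → ℝ := fun w => if G.Reachable u w.castSucc then 1 else 0 with hc
  have hpos : ∀ w, position c w = if G.Reachable u w then 1 else 0 := by
    intro w
    refine Fin.lastCases ?_ (fun i => ?_) w
    · simp [position, hu']
    · simp [position, hc]
  have hedge : ∀ e, G.Reachable (Γ.src e) (Γ.tgt e) := by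
    intro e
    by_cases h : Γ.src e = Γ.tgt e
    · rw [h]
    · refine SimpleGraph.Adj.reachable ?_
      rw [hG, toSimpleGraph, SimpleGraph.fromRel_adj]
      exact ⟨h, Or.inl ⟨e, Set.mem_univ _, rfl, rfl⟩⟩
  have h0 : Γ.edgeMap c = Γ.edgeMap 0 := by
    rw [map_zero]
    ext e
    change position c (Γ.tgt e) - position c (Γ.src e) = 0
    rw [hpos, hpos, sub_eq_zero]
    have : G.Reachable u (Γ.tgt e) ↔ G.Reachable u (Γ.src e) :=
      ⟨fun h => h.trans (hedge e).symm, fun h => h.trans (hedge e)⟩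
    simp only [this]
  have h1 : position c u = 1 := by rw [hpos, if_pos (SimpleGraph.Reachable.refl u)]
  rw [hinj h0] at h1
  have h2 : position (0 : Fin n → ℝ) u = 0 := by
    refine Fin.lastCases ?_ (fun i => ?_) u <;> simp [position]
  rw [h2] at h1
  exact zero_ne_one h1

theorem alpha_mul_self_eq_zero (h : ¬ Γ.IsTree) {a : Fin m → ℝ} (ha : ∀ e, 0 < a e) :
    Γ.alpha a * Γ.alpha a = 0 := by
  rw [Γ.alpha_eq ha]
  by_cases hinj : Function.Injective Γ.edgeMap
  · have hmn : n ≠ m := fun hmn => h ⟨Γ.isConnected_of_injective hinj, by simp [loopNumber, hmn]⟩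
    rw [smul_mul_smul_comm, ← map_mul, gaussForm_cycleForm_mul_self hinj ha hmn, map_zero,
      smul_zero]
  · rw [Γ.cycleForm_eq_zero hinj, ← gaussFormHom_apply, map_zero, map_zero, smul_zero, zero_mul]

end FeynmanGraph

end

/-! ### The vanishing of Q_E -/

/-- Two fixed-point-free involutions `a`, `b` of a finite set are the edges of a 2-regular multigraph; the
rotation of one of its cycles is an odd permutation that preserves the edges. -/
theorem Equiv.Perm.exists_odd_of_involutions {α : Type*} [Fintype α] [DecidableEq α] [Nonempty α]
    {a b : Equiv.Perm α} (ha : a * a = 1) (hb : b * b = 1) (hfa : ∀ v, a v ≠ v)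
    (hfb : ∀ v, b v ≠ v) :
    ∃ π : Equiv.Perm α, Equiv.Perm.sign π = -1 ∧
      (∀ v, π (a v) = a (π v) ∨ π (a v) = b (π v)) ∧
      (∀ v, π (b v) = a (π v) ∨ π (b v) = b (π v)) := by
  classical
  obtain ⟨v₀⟩ := ‹Nonempty α›
  have haa : ∀ v, a (a v) = v := fun v => by rw [← Equiv.Perm.mul_apply, ha, Equiv.Perm.one_apply]
  have hbb : ∀ v, b (b v) = v := fun v => by rw [← Equiv.Perm.mul_apply, hb, Equiv.Perm.one_apply]
  set r := b * a with hr
  have hra : ∀ k : ℤ, a * r ^ k = r ^ (-k) * a := by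
    intro k
    have hai : a⁻¹ = a := inv_eq_of_mul_eq_one_left ha
    have hbi : b⁻¹ = b := inv_eq_of_mul_eq_one_left hb
    have h1 : a * r * a⁻¹ = r⁻¹ := by
      rw [hr, mul_inv_rev, hai, hbi, mul_assoc, mul_assoc, ha, mul_one]
    rw [zpow_neg, ← inv_zpow, ← h1, conj_zpow, hai, mul_assoc, ha, mul_one]
  -- In the dihedral group generated by `a` and `b`, the element a r^k is conjugate to `a` for even
  -- k and to `b` for odd k.
  have hfix : ∀ (k : ℤ) v, a ((r ^ k) v) ≠ v := by
    intro k v h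
    obtain ⟨t, rfl | rfl⟩ := Int.even_or_odd' k
    · have h1 : r ^ (-t) * a * r ^ t = a * r ^ (2 * t) := by
        rw [← hra, mul_assoc, ← zpow_add]; congr 2; ring
      rw [← Equiv.Perm.mul_apply, ← h1] at h
      refine hfa ((r ^ t) v) ?_
      have h2 := congrArg (r ^ t) h
      rwa [← Equiv.Perm.mul_apply, mul_assoc, ← mul_assoc, ← zpow_add, add_neg_cancel, zpow_zero,
        one_mul, Equiv.Perm.mul_apply] at h2
    · have h1 : r ^ (-t) * (a * r) * r ^ t = a * r ^ (2 * t + 1) := by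
        have : r ^ (2 * t + 1) = r ^ t * (r * r ^ t) := by
          rw [← zpow_one_add, ← zpow_add]; congr 1; ring
        rw [this, ← mul_assoc a (r ^ t), hra]
        simp only [mul_assoc]
      rw [← Equiv.Perm.mul_apply, ← h1] at h
      have h2 := congrArg (r ^ t) h
      rw [← Equiv.Perm.mul_apply, mul_assoc, ← mul_assoc (r ^ t), ← zpow_add, add_neg_cancel,
        zpow_zero, one_mul, Equiv.Perm.mul_apply, Equiv.Perm.mul_apply] at h2
      refine hfb (a ((r ^ t) v)) ?_
      have h3 := congrArg a h2
      rwa [haa, hr, Equiv.Perm.mul_apply] at h3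
  -- The cycle through `v₀` consists of P and its image under `a`, which are disjoint by `hfix`.
  set P : α → Prop := fun v => r.SameCycle v₀ v with hP
  have hdisj : ∀ v, P v → ¬ P (a v) := by
    intro v h1 h2
    obtain ⟨k, hk⟩ := h2.symm.trans h1
    exact hfix k (a v) (by rw [hk])
  have hPb : ∀ v, P (b v) ↔ P (a v) := by
    intro v
    have h : b v = r (a v) := by rw [hr, Equiv.Perm.mul_apply, haa]
    rw [h]
    exact Equiv.Perm.sameCycle_apply_right
  have hPab : ∀ v, P (a (b v)) ↔ P v := by
    intro v
    rw [← hPb, hbb]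
  -- One step around the cycle: along `a` out of P, along `b` back into P. Two steps from P make one
  -- `r`.
  let p : Equiv.Perm α :=
    { toFun := fun v => if P v then a v else if P (a v) then b v else v
      invFun := fun v => if P v then b v else if P (a v) then a v else v
      left_inv := fun v => by
        by_cases h1 : P v
        · simp [h1, hdisj v h1, haa]
        · by_cases h2 : P (a v)
          · simp [h1, h2, hPb, hbb]
          · simp [h1, h2]
      right_inv := fun v => by
        by_cases h1 : P v
        · simp [h1, hPb, hdisj v h1, hPab, hbb]
        · by_cases h2 : P (a v)
          · simp [h1, h2, haa]
          · simp [h1, h2] }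
  have hp : ∀ v, p v = if P v then a v else if P (a v) then b v else v := fun v => rfl
  have hp1 : ∀ v, P v → p v = a v := fun v h => by rw [hp, if_pos h]
  have hp2 : ∀ v, P (a v) → p v = b v := fun v h => by
    rw [hp, if_neg fun h' => hdisj v h' h, if_pos h]
  have hp3 : ∀ v, ¬ P v → ¬ P (a v) → p v = v := fun v h h' => by rw [hp, if_neg h, if_neg h']
  have hP0 : P v₀ := Equiv.Perm.SameCycle.refl _ _
  have hpow : ∀ k : ℕ, (p ^ (2 * k)) v₀ = (r ^ k) v₀ := by
    intro k
    induction k with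
    | zero => simp
    | succ k ih =>
      have hk : P ((r ^ k) v₀) := ⟨k, by simp⟩
      rw [Nat.mul_succ, add_comm, pow_add, Equiv.Perm.mul_apply, ih, pow_succ' r,
        Equiv.Perm.mul_apply, pow_two, Equiv.Perm.mul_apply, hp1 _ hk, hp2 _ (by rwa [haa])]
      rfl
  have hmoved : ∀ v, p v ≠ v ↔ P v ∨ P (a v) := by
    intro v
    by_cases h1 : P v
    · simp [hp1 v h1, hfa, h1]
    · by_cases h2 : P (a v)
      · simp [hp2 v h2, hfb, h2]
      · simp [hp3 v h1 h2, h1, h2]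
  have hP' : ∀ v, P v → p.SameCycle v₀ v := by
    intro v h
    obtain ⟨k, hk⟩ := h.exists_nat_pow_eq
    exact ⟨(2 * k : ℕ), by rw [zpow_natCast, hpow, hk]⟩
  have hcycle : p.IsCycle := by
    refine ⟨v₀, (hmoved v₀).mpr (Or.inl hP0), fun v hv => ?_⟩
    rcases (hmoved v).mp hv with h | h
    · exact hP' v h
    · have h1 := hP' _ h
      have h2 : p (a v) = v := by rw [hp1 _ h, haa]
      rw [← h2]
      exact Equiv.Perm.sameCycle_apply_right.mpr h1
  have heven : Even p.support.card := by
    have h1 : p.support = (Finset.univ.filter P) ∪ (Finset.univ.filter P).map a.toEmbedding := by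
      ext v
      simp only [Equiv.Perm.mem_support, hmoved, Finset.mem_union, Finset.mem_filter,
        Finset.mem_univ, true_and, Finset.mem_map_equiv]
      rw [show a.symm v = a v from (Equiv.symm_apply_eq a).mpr (haa v).symm]
    rw [h1, Finset.card_union_of_disjoint, Finset.card_map]
    · exact ⟨_, rfl⟩
    · rw [Finset.disjoint_left]
      intro v hv hv'
      simp only [Finset.mem_filter, Finset.mem_univ, true_and, Finset.mem_map_equiv] at hv hv'
      rw [show a.symm v = a v from (Equiv.symm_apply_eq a).mpr (haa v).symm] at hv'
      exact hdisj v hv hv'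
  -- The rotation exchanges the two kinds of edges on its cycle and fixes all other edges.
  refine ⟨p, by rw [hcycle.sign, heven.neg_one_pow], fun v => ?_, fun v => ?_⟩
  · by_cases h1 : P v
    · right; rw [hp1 v h1, hp2 _ (by rwa [haa])]
    · by_cases h2 : P (a v)
      · right; rw [hp2 v h2, hp1 _ h2, haa, hbb]
      · left; rw [hp3 v h1 h2, hp3 _ h2 (by rwa [haa])]
  · by_cases h1 : P v
    · left; rw [hp1 v h1, hp2 _ (by rwa [hPab]), hbb, haa]
    · by_cases h2 : P (a v)
      · left; rw [hp2 v h2, hp1 _ (by rwa [hPb])]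
      · right; rw [hp3 v h1 h2, hp3 _ (by rwa [hPb]) (by rwa [hPab])]

noncomputable section

namespace FeynmanGraph

variable {n m : ℕ} (Γ : FeynmanGraph n m)

/-! ### Symmetry of the Dodgson polynomials -/

/-- The signs `+1` on edges and `-1` on vertices. -/
def blockSign (n m : ℕ) : Fin (m + n) → MvPolynomial (Fin m) ℝ :=
  Fin.append (fun _ => 1) fun _ => -1

theorem expandedLaplacian_symm (i j : Fin (m + n)) :
    Γ.expandedLaplacian j i = blockSign n m i * Γ.expandedLaplacian i j * blockSign n m j := by
  refine Fin.addCases (fun e => ?_) (fun v => ?_) i <;>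
  refine Fin.addCases (fun e' => ?_) (fun v' => ?_) j <;>
  simp [blockSign, expandedLaplacian, Matrix.diagonal_apply]
  by_cases h : e = e'
  · simp [h]
  · simp [h, Ne.symm h]

theorem prod_blockSign_compl {e : Fin m} {k : ℕ}
    (h : ({Fin.castAdd n e}ᶜ : Finset (Fin (m + n))).card = k) :
    ∏ i, blockSign n m (({Fin.castAdd n e}ᶜ : Finset (Fin (m + n))).orderEmbOfFin h i) =
      (-1) ^ n := by
  classical
  have h1 : ∏ i, blockSign n m (({Fin.castAdd n e}ᶜ : Finset (Fin (m + n))).orderEmbOfFin h i) =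
      ∏ i ∈ ({Fin.castAdd n e}ᶜ : Finset (Fin (m + n))), blockSign n m i := by
    rw [← Finset.prod_image (s := Finset.univ) (f := blockSign n m)
      (Finset.orderEmbOfFin _ h).injective.injOn]
    simp
  have h2 := Finset.prod_mul_prod_compl {Fin.castAdd n e} (blockSign n m)
  rw [Finset.prod_singleton, Fin.prod_univ_add] at h2
  rw [h1]
  simpa [blockSign] using h2

/-- The transpose of the expanded Laplacian is its conjugate by the block signs. Deleting an edge
keeps all n vertex signs, so each of the two sign matrices has determinant (-1)^n. -/
theorem det_submatrix_compl_comm {e e' : Fin m} {k : ℕ}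
    (h : ({Fin.castAdd n e}ᶜ : Finset (Fin (m + n))).card = k)
    (h' : ({Fin.castAdd n e'}ᶜ : Finset (Fin (m + n))).card = k) :
    (Γ.expandedLaplacian.submatrix (({Fin.castAdd n e}ᶜ : Finset (Fin (m + n))).orderEmbOfFin h)
      (({Fin.castAdd n e'}ᶜ : Finset (Fin (m + n))).orderEmbOfFin h')).det =
    (Γ.expandedLaplacian.submatrix (({Fin.castAdd n e'}ᶜ : Finset (Fin (m + n))).orderEmbOfFin h')
      (({Fin.castAdd n e}ᶜ : Finset (Fin (m + n))).orderEmbOfFin h)).det := by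
  set f := ({Fin.castAdd n e}ᶜ : Finset (Fin (m + n))).orderEmbOfFin h
  set g := ({Fin.castAdd n e'}ᶜ : Finset (Fin (m + n))).orderEmbOfFin h'
  have h1 : Γ.expandedLaplacian.submatrix f g =
      (Matrix.diagonal (fun i => blockSign n m (g i)) * Γ.expandedLaplacian.submatrix g f *
        Matrix.diagonal (fun i => blockSign n m (f i))).transpose := by
    ext i j
    rw [Matrix.transpose_apply, Matrix.mul_diagonal, Matrix.diagonal_mul, Matrix.submatrix_apply,
      Matrix.submatrix_apply, expandedLaplacian_symm]
  rw [h1, Matrix.det_transpose, Matrix.det_mul, Matrix.det_mul, Matrix.det_diagonal,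
    Matrix.det_diagonal, prod_blockSign_compl, prod_blockSign_compl, mul_right_comm, ← pow_add,
    Even.neg_one_pow ⟨n, rfl⟩, one_mul]

theorem edgeDodgson_comm (i j : Fin m) : Γ.edgeDodgson i j = Γ.edgeDodgson j i :=
  Γ.det_submatrix_compl_comm _ _

/-! ### The sign of a word -/

/-- A product over pairs of positions transforms by the sign of a permutation if its kernel is
antisymmetric. The value 0 makes that true on the diagonal too. -/
theorem wordSign_eq_prod {k : ℕ} {w : Fin k → Fin m} (hw : Function.Injective w) :
    wordSign w = ∏ j, ∏ i ∈ Finset.Iio j,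
      (if w j < w i then -1 else if w i < w j then 1 else 0) := by
  have h : ∀ j, ∏ i ∈ Finset.Iio j, (if w j < w i then (-1 : ℤ) else if w i < w j then 1 else 0) =
      ∏ i, if i < j ∧ w j < w i then -1 else 1 := by
    intro j
    rw [← Finset.prod_subset (Finset.subset_univ (Finset.Iio j))]
    · refine Finset.prod_congr rfl fun i hi => ?_
      have hij : i < j := Finset.mem_Iio.mp hi
      rcases lt_or_gt_of_ne (hw.ne hij.ne) with h1 | h1
      · simp [h1, h1.not_gt]
      · simp [h1, hij]
    · intro i _ hi
      rw [if_neg fun h => hi (Finset.mem_Iio.mpr h.1)]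
  simp_rw [h]
  rw [Finset.prod_comm, ← Finset.prod_product', wordSign, Finset.prod_ite, Finset.prod_const,
    Finset.prod_const_one, mul_one, Finset.univ_product_univ]

theorem wordSign_comp_perm {k : ℕ} {w : Fin k → Fin m} (hw : Function.Injective w)
    (σ : Equiv.Perm (Fin k)) : wordSign (w ∘ σ) = Equiv.Perm.sign σ * wordSign w := by
  rw [wordSign_eq_prod (hw.comp σ.injective), wordSign_eq_prod hw]
  have := σ.prod_Iio_comp_eq_sign_mul_prod (R := ℤ)
    (f := fun i j => if w j < w i then -1 else if w i < w j then 1 else 0) (fun i j => by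
      rcases lt_trichotomy (w i) (w j) with h | h | h
      · simp [h, h.not_gt]
      · simp [h]
      · simp [h, h.not_gt])
  simpa using this

/-- The sign of a word that is written as a pair of words. -/
def pairSign {L : ℕ} (g : Fin L ⊕ Fin L → Fin m) : ℤ := wordSign (g ∘ finSumFinEquiv.symm)

theorem pairSign_comp_perm {L : ℕ} {g : Fin L ⊕ Fin L → Fin m} (hg : Function.Injective g)
    (π : Equiv.Perm (Fin L ⊕ Fin L)) : pairSign (g ∘ π) = Equiv.Perm.sign π * pairSign g := by
  have h := wordSign_comp_perm (hg.comp finSumFinEquiv.symm.injective) (finSumFinEquiv.permCongr π)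
  rw [Equiv.Perm.sign_permCongr] at h
  rw [pairSign, pairSign, ← h]
  congr 1
  ext i
  simp

theorem wordSign_append {L : ℕ} (f g : Fin L → Fin m) :
    wordSign (Fin.append f g) = pairSign (Sum.elim f g) := by
  rw [pairSign]
  congr 1
  ext i
  refine Fin.addCases (fun j => ?_) (fun j => ?_) i
  · simp
  · rw [Fin.append_right, Function.comp_apply, finSumFinEquiv_symm_apply_natAdd, Sum.elim_inr]

end FeynmanGraph

end

noncomputable section

namespace FeynmanGraph

variable {n m : ℕ} (Γ : FeynmanGraph n m)

/-! ### The multigraph of a term of `Q` -/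

/-- The involution that swaps the letters `2k` and `2k + 1`. -/
def partner {L : ℕ} (hL : Even L) (j : Fin L) : Fin L :=
  ⟨if (j : ℕ) % 2 = 0 then j + 1 else j - 1, by
    obtain ⟨K, rfl⟩ := hL
    split_ifs <;> omega⟩

theorem partner_partner {L : ℕ} (hL : Even L) (j : Fin L) : partner hL (partner hL j) = j := by
  apply Fin.ext
  simp only [partner]
  split_ifs <;> omega

theorem partner_ne {L : ℕ} (hL : Even L) (j : Fin L) : partner hL j ≠ j := by
  intro h
  have := congrArg Fin.val h
  simp only [partner] at this
  split_ifs at this <;> omega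

/-- The permutation of two words that swaps the letters `2k` and `2k + 1` in both of them. -/
def partnerPerm {L : ℕ} (hL : Even L) : Equiv.Perm (Fin L ⊕ Fin L) :=
  Function.Involutive.toPerm (Sum.map (partner hL) (partner hL)) (by
    rintro (j | j) <;> simp [partner_partner])

@[simp] theorem partnerPerm_inl {L : ℕ} (hL : Even L) (j : Fin L) :
    partnerPerm hL (Sum.inl j) = Sum.inl (partner hL j) := rfl

@[simp] theorem partnerPerm_inr {L : ℕ} (hL : Even L) (j : Fin L) :
    partnerPerm hL (Sum.inr j) = Sum.inr (partner hL j) := rfl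

/-- The permutation of two words that swaps the letters matched by `ρ`. -/
def matchPerm {L : ℕ} (ρ : Equiv.Perm (Fin L)) : Equiv.Perm (Fin L ⊕ Fin L) :=
  Function.Involutive.toPerm (Sum.elim (Sum.inr ∘ ρ) (Sum.inl ∘ ρ.symm)) (by
    rintro (j | j) <;> simp)

@[simp] theorem matchPerm_inl {L : ℕ} (ρ : Equiv.Perm (Fin L)) (j : Fin L) :
    matchPerm ρ (Sum.inl j) = Sum.inr (ρ j) := rfl

@[simp] theorem matchPerm_inr {L : ℕ} (ρ : Equiv.Perm (Fin L)) (j : Fin L) :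
    matchPerm ρ (Sum.inr j) = Sum.inl (ρ.symm j) := rfl

/-- The edges of the multigraph: those of the matching `ρ`, and the pairs `{2k, 2k + 1}` in both words. -/
def termEdge {L : ℕ} (ρ : Equiv.Perm (Fin L)) :
    Fin L ⊕ Fin (L / 2) ⊕ Fin (L / 2) → Sym2 (Fin L ⊕ Fin L) :=
  Sum.elim (fun i => s(Sum.inl i, Sum.inr (ρ i))) (Sum.elim
    (fun k => s(Sum.inl ⟨2 * k, by omega⟩, Sum.inl ⟨2 * k + 1, by omega⟩))
    (fun k => s(Sum.inr ⟨2 * k, by omega⟩, Sum.inr ⟨2 * k + 1, by omega⟩)))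

/-- Matching edges join the two words and the other edges stay within one, so there are no double
edges. A weight is thus a product over a set of edges, and a permutation need only preserve that
set. -/
theorem termEdge_injective {L : ℕ} (ρ : Equiv.Perm (Fin L)) : Function.Injective (termEdge ρ) := by
  rintro (i | k | k) (i' | k' | k') h <;> simp [termEdge, Fin.ext_iff] at h ⊢ <;> omega

theorem exists_termEdge_eq {L : ℕ} (hL : Even L) (ρ : Equiv.Perm (Fin L))
    (x : Fin L ⊕ Fin (L / 2) ⊕ Fin (L / 2)) :
    ∃ v, termEdge ρ x = s(v, matchPerm ρ v) ∨ termEdge ρ x = s(v, partnerPerm hL v) := by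
  rcases x with i | k | k
  · exact ⟨Sum.inl i, Or.inl rfl⟩
  · refine ⟨Sum.inl ⟨2 * k, by omega⟩, Or.inr ?_⟩
    simp [termEdge, partner]
  · refine ⟨Sum.inr ⟨2 * k, by omega⟩, Or.inr ?_⟩
    simp [termEdge, partner]

theorem mk_matchPerm_mem {L : ℕ} (ρ : Equiv.Perm (Fin L)) (v : Fin L ⊕ Fin L) :
    ∃ x, termEdge ρ x = s(v, matchPerm ρ v) := by
  rcases v with i | i
  · exact ⟨Sum.inl i, rfl⟩
  · refine ⟨Sum.inl (ρ.symm i), ?_⟩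
    simp [termEdge, Sym2.eq_swap]

theorem mk_partnerPerm_mem {L : ℕ} (hL : Even L) (ρ : Equiv.Perm (Fin L)) (v : Fin L ⊕ Fin L) :
    ∃ x, termEdge ρ x = s(v, partnerPerm hL v) := by
  have hlt : ∀ i : Fin L, (i : ℕ) / 2 < L / 2 := fun i => by
    obtain ⟨K, rfl⟩ := hL
    omega
  have hmk : ∀ i : Fin L, s((⟨2 * (i / 2), by omega⟩ : Fin L),
      ⟨2 * (i / 2) + 1, by have := hlt i; omega⟩) = s(i, partner hL i) := fun i => by
    rw [Sym2.eq_iff]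
    simp only [Fin.ext_iff, partner]
    split_ifs <;> omega
  rcases v with i | i
  · exact ⟨Sum.inr (Sum.inl ⟨i / 2, hlt i⟩), congrArg (Sym2.map Sum.inl) (hmk i)⟩
  · exact ⟨Sum.inr (Sum.inr ⟨i / 2, hlt i⟩), congrArg (Sym2.map Sum.inr) (hmk i)⟩

/-- The Dodgson polynomial of an edge of the multigraph, for the letters `g`. -/
def edgeWeight {α : Type*} (g : α → Fin m) : Sym2 α → MvPolynomial (Fin m) ℝ :=
  Sym2.lift ⟨fun u v => Γ.edgeDodgson (g u) (g v), fun _ _ => Γ.edgeDodgson_comm _ _⟩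

theorem edgeWeight_comp {α β : Type*} (g : β → Fin m) (π : α → β) (s : Sym2 α) :
    Γ.edgeWeight (g ∘ π) s = Γ.edgeWeight g (s.map π) := by
  induction s with | _ u v => rfl

/-- The product of the Dodgson polynomials over the multigraph. -/
def termWeight {L : ℕ} (ρ : Equiv.Perm (Fin L)) (g : Fin L ⊕ Fin L → Fin m) :
    MvPolynomial (Fin m) ℝ := ∏ x, Γ.edgeWeight g (termEdge ρ x)

theorem termWeight_comp_perm {L : ℕ} (ρ : Equiv.Perm (Fin L)) (g : Fin L ⊕ Fin L → Fin m)
    {π : Equiv.Perm (Fin L ⊕ Fin L)} (hπ : ∀ x, ∃ y, termEdge ρ y = (termEdge ρ x).map π) :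
    Γ.termWeight ρ (g ∘ π) = Γ.termWeight ρ g := by
  classical
  set G := Finset.univ.image (termEdge ρ) with hG
  have h1 : ∀ F : Sym2 (Fin L ⊕ Fin L) → MvPolynomial (Fin m) ℝ,
      ∏ x, F (termEdge ρ x) = ∏ s ∈ G, F s := fun F =>
    (Finset.prod_image (termEdge_injective ρ).injOn).symm
  have hinj : Function.Injective (Sym2.map π) := Sym2.map.injective π.injective
  have h2 : G.image (Sym2.map π) = G := by
    refine Finset.eq_of_subset_of_card_le ?_ (Finset.card_image_of_injective _ hinj).ge
    intro s hs
    obtain ⟨t, ht, rfl⟩ := Finset.mem_image.mp hs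
    obtain ⟨x, -, rfl⟩ := Finset.mem_image.mp ht
    obtain ⟨y, hy⟩ := hπ x
    exact Finset.mem_image.mpr ⟨y, Finset.mem_univ _, hy⟩
  simp only [termWeight, edgeWeight_comp]
  rw [h1 fun s => Γ.edgeWeight g (s.map π), h1, ← Finset.prod_image (f := Γ.edgeWeight g)
    hinj.injOn, h2]

theorem exists_odd_termEdge_perm {L : ℕ} (hL : Even L) (h0 : 0 < L) (ρ : Equiv.Perm (Fin L)) :
    ∃ π : Equiv.Perm (Fin L ⊕ Fin L), Equiv.Perm.sign π = -1 ∧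
      ∀ x, ∃ y, termEdge ρ y = (termEdge ρ x).map π := by
  have : Nonempty (Fin L ⊕ Fin L) := ⟨Sum.inl ⟨0, h0⟩⟩
  obtain ⟨π, hπ, ha, hb⟩ := Equiv.Perm.exists_odd_of_involutions (a := matchPerm ρ)
    (b := partnerPerm hL)
    (Equiv.ext fun v => by rcases v with i | i <;> simp)
    (Equiv.ext fun v => by rcases v with i | i <;> simp [partner_partner])
    (fun v => by rcases v with i | i <;> simp)
    (fun v => by rcases v with i | i <;> simp [partner_ne])
  refine ⟨π, hπ, fun x => ?_⟩
  obtain ⟨v, h | h⟩ := exists_termEdge_eq hL ρ x <;> rw [h, Sym2.map_mk]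
  · rcases ha v with h' | h'
    · obtain ⟨y, hy⟩ := mk_matchPerm_mem ρ (π v); exact ⟨y, by simp [hy, h']⟩
    · obtain ⟨y, hy⟩ := mk_partnerPerm_mem hL ρ (π v); exact ⟨y, by simp [hy, h']⟩
  · rcases hb v with h' | h'
    · obtain ⟨y, hy⟩ := mk_matchPerm_mem ρ (π v); exact ⟨y, by simp [hy, h']⟩
    · obtain ⟨y, hy⟩ := mk_partnerPerm_mem hL ρ (π v); exact ⟨y, by simp [hy, h']⟩

/-- The pairs of words that use every letter of `E` exactly once. -/
abbrev Spelling (L : ℕ) (E : Finset (Fin m)) : Type :=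
  {g : Fin L ⊕ Fin L → Fin m // Function.Injective g ∧ Finset.univ.image g = E}

theorem sum_spelling_eq_zero {L : ℕ} (hL : Even L) (h0 : 0 < L) (E : Finset (Fin m))
    (ρ : Equiv.Perm (Fin L)) :
    ∑ g : Spelling L E, (pairSign g.1 : MvPolynomial (Fin m) ℝ) * Γ.termWeight ρ g.1 = 0 := by
  obtain ⟨π, hπ, hedge⟩ := exists_odd_termEdge_perm hL h0 ρ
  have himg : ∀ (τ : Equiv.Perm (Fin L ⊕ Fin L)) (g : Fin L ⊕ Fin L → Fin m),
      Finset.univ.image (g ∘ τ) = Finset.univ.image g := fun τ g => by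
    rw [← Finset.image_image, Finset.image_univ_equiv]
  let e : Equiv.Perm (Spelling L E) :=
    { toFun := fun g => ⟨g.1 ∘ π, g.2.1.comp π.injective, (himg _ _).trans g.2.2⟩
      invFun := fun g => ⟨g.1 ∘ π.symm, g.2.1.comp π.symm.injective, (himg _ _).trans g.2.2⟩
      left_inv := fun g => Subtype.ext (by ext; simp)
      right_inv := fun g => Subtype.ext (by ext; simp) }
  -- Reindexing the spellings by the odd permutation turns the sum into its negative.
  rw [← self_eq_neg, ← Finset.sum_neg_distrib]
  refine Eq.symm ((Fintype.sum_equiv e _ _ fun g => ?_))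
  change _ = (pairSign (g.1 ∘ π) : MvPolynomial (Fin m) ℝ) * Γ.termWeight ρ (g.1 ∘ π)
  rw [pairSign_comp_perm g.2.1, Γ.termWeight_comp_perm ρ g.1 hedge, hπ]
  simp

/-! ### The vanishing of `Q` -/

theorem exists_perm_comp_eq {L : ℕ} {f h : Fin L → Fin m} (hf : Function.Injective f)
    (hfh : ∀ i, f i ∈ Set.range h) : ∃ σ : Equiv.Perm (Fin L), h ∘ σ = f := by
  choose σ hσ using hfh
  have hinj : Function.Injective σ := fun i j hij => hf (by rw [← hσ i, ← hσ j, hij])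
  exact ⟨Equiv.ofBijective σ (Finite.injective_iff_bijective.mp hinj), funext hσ⟩

variable {L : ℕ} {E : Finset (Fin m)}

theorem Halving.fst_injective (p : Halving L E) : Function.Injective p.fst :=
  (Finset.orderEmbOfFin _ _).injective

theorem Halving.snd_injective (p : Halving L E) : Function.Injective p.snd :=
  (Finset.orderEmbOfFin _ _).injective

theorem Halving.range_fst (p : Halving L E) : Set.range p.fst = p.1.1 :=
  Finset.range_orderEmbOfFin _ _

theorem Halving.range_snd (p : Halving L E) : Set.range p.snd = p.1.2 :=
  Finset.range_orderEmbOfFin _ _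

theorem Halving.elim_injective (p : Halving L E) : Function.Injective (Sum.elim p.fst p.snd) :=
  p.fst_injective.sumElim p.snd_injective fun i j h => by
    have h1 : p.fst i ∈ p.1.1 := by
      rw [← Finset.mem_coe, ← p.range_fst]; exact ⟨i, rfl⟩
    have h2 : p.snd j ∈ p.1.2 := by
      rw [← Finset.mem_coe, ← p.range_snd]; exact ⟨j, rfl⟩
    exact Finset.disjoint_left.mp p.2.1 h1 (h ▸ h2)

/-- The pair of words that consists of a halving of `E` and of rearrangements of both halves. -/
def spell (x : Halving L E × Equiv.Perm (Fin L) × Equiv.Perm (Fin L)) : Spelling L E :=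
  ⟨Sum.elim x.1.fst x.1.snd ∘ Equiv.sumCongr x.2.1 x.2.2,
    x.1.elim_injective.comp (Equiv.injective _), by
    apply Finset.coe_injective
    rw [Finset.coe_image, Finset.coe_univ, Set.image_univ, EquivLike.range_comp,
      Set.Sum.elim_range, x.1.range_fst, x.1.range_snd, ← Finset.coe_union, x.1.2.2.1]⟩

theorem spell_bijective : Function.Bijective (spell (L := L) (E := E)) := by
  classical
  constructor
  · rintro ⟨p, σ₁, σ₂⟩ ⟨q, τ₁, τ₂⟩ h
    have h0 := congrArg Subtype.val h
    have h1 : p.fst ∘ σ₁ = q.fst ∘ τ₁ := funext fun i => congrFun h0 (Sum.inl i)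
    have h2 : p.snd ∘ σ₂ = q.snd ∘ τ₂ := funext fun i => congrFun h0 (Sum.inr i)
    have hpq : p = q := by
      apply Subtype.ext
      apply Prod.ext <;> apply Finset.coe_injective
      · rw [← p.range_fst, ← q.range_fst, ← EquivLike.range_comp p.fst σ₁, h1,
          EquivLike.range_comp]
      · rw [← p.range_snd, ← q.range_snd, ← EquivLike.range_comp p.snd σ₂, h2,
          EquivLike.range_comp]
    subst hpq
    have h3 : σ₁ = τ₁ := Equiv.ext fun i => p.fst_injective (congrFun h1 i)
    have h4 : σ₂ = τ₂ := Equiv.ext fun i => p.snd_injective (congrFun h2 i)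
    rw [h3, h4]
  · rintro ⟨g, hg, hE⟩
    have hl : Function.Injective (g ∘ Sum.inl) := hg.comp Sum.inl_injective
    have hr : Function.Injective (g ∘ Sum.inr) := hg.comp Sum.inr_injective
    let p : Halving L E := ⟨(Finset.univ.image (g ∘ Sum.inl), Finset.univ.image (g ∘ Sum.inr)), by
      refine ⟨?_, ?_, ?_, ?_⟩
      · rw [Finset.disjoint_left]
        intro x hx hx'
        obtain ⟨i, -, hi⟩ := Finset.mem_image.mp hx
        obtain ⟨j, -, hj⟩ := Finset.mem_image.mp hx'
        exact Sum.inl_ne_inr (hg (hi.trans hj.symm))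
      · rw [← hE]
        ext x
        simp
      · rw [Finset.card_image_of_injective _ hl, Finset.card_fin]
      · rw [Finset.card_image_of_injective _ hr, Finset.card_fin]⟩
    obtain ⟨σ₁, h1⟩ := exists_perm_comp_eq hl (h := p.fst) fun i => by
      rw [p.range_fst]; simp [p]
    obtain ⟨σ₂, h2⟩ := exists_perm_comp_eq hr (h := p.snd) fun i => by
      rw [p.range_snd]; simp [p]
    refine ⟨(p, σ₁, σ₂), Subtype.ext (funext fun v => ?_)⟩
    rcases v with i | i
    · exact congrFun h1 i
    · exact congrFun h2 i

/-- Substitute σ₂ρσ₁⁻¹ for the matching. The signs that come out are those by which the sign of the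
pair of words changes under rearrangement; the unsigned pairing sums need them to combine with the
word sign. -/
theorem matchingSum_eq (w w' : Fin L → Fin m) (σ₁ σ₂ : Equiv.Perm (Fin L)) :
    Γ.matchingSum w w' = ((Equiv.Perm.sign σ₁ * Equiv.Perm.sign σ₂ : ℤ) : MvPolynomial (Fin m) ℝ) *
      ∑ ρ : Equiv.Perm (Fin L), ((Equiv.Perm.sign ρ : ℤ) : MvPolynomial (Fin m) ℝ) *
        ∏ i, Γ.edgeDodgson (w (σ₁ i)) (w' (σ₂ (ρ i))) := by
  rw [matchingSum, Finset.mul_sum]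
  refine (Fintype.sum_equiv ((Equiv.mulLeft σ₂).trans (Equiv.mulRight σ₁⁻¹)) _ _ fun ρ => ?_).symm
  simp only [Equiv.trans_apply, Equiv.coe_mulLeft, Equiv.coe_mulRight]
  rw [← mul_assoc]
  congr 1
  · rw [← Int.cast_mul]
    congr 1
    simp only [map_mul, Equiv.Perm.sign_inv, Units.val_mul]
    ring
  · refine Fintype.prod_equiv σ₁ _ _ fun i => ?_
    simp

theorem Q_eq_zero (hL : Even L) (h0 : 0 < L) : Γ.Q L E = 0 := by
  have h1 : ∀ (p : Halving L E) (σ₁ σ₂ : Equiv.Perm (Fin L)),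
      (wordSign (Fin.append p.fst p.snd) : MvPolynomial (Fin m) ℝ) * Γ.matchingSum p.fst p.snd *
        (∏ k : Fin (L / 2), Γ.edgeDodgson (p.fst (σ₁ ⟨2 * k, by omega⟩))
          (p.fst (σ₁ ⟨2 * k + 1, by omega⟩))) *
        (∏ k : Fin (L / 2), Γ.edgeDodgson (p.snd (σ₂ ⟨2 * k, by omega⟩))
          (p.snd (σ₂ ⟨2 * k + 1, by omega⟩))) =
      ∑ ρ : Equiv.Perm (Fin L), ((Equiv.Perm.sign ρ : ℤ) : MvPolynomial (Fin m) ℝ) *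
        ((pairSign (spell (p, σ₁, σ₂)).1 : MvPolynomial (Fin m) ℝ) *
          Γ.termWeight ρ (spell (p, σ₁, σ₂)).1) := by
    intro p σ₁ σ₂
    have hs : pairSign (spell (p, σ₁, σ₂)).1 =
        Equiv.Perm.sign σ₁ * Equiv.Perm.sign σ₂ * wordSign (Fin.append p.fst p.snd) := by
      rw [wordSign_append]
      refine (pairSign_comp_perm p.elim_injective (Equiv.Perm.sumCongr σ₁ σ₂)).trans ?_
      rw [Equiv.Perm.sign_sumCongr, Units.val_mul]
    rw [Γ.matchingSum_eq _ _ σ₁ σ₂, hs, Finset.mul_sum, Finset.mul_sum, Finset.sum_mul,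
      Finset.sum_mul]
    refine Finset.sum_congr rfl fun ρ _ => ?_
    have hw : Γ.termWeight ρ (spell (p, σ₁, σ₂)).1 =
        (∏ i, Γ.edgeDodgson (p.fst (σ₁ i)) (p.snd (σ₂ (ρ i)))) *
        ((∏ k : Fin (L / 2), Γ.edgeDodgson (p.fst (σ₁ ⟨2 * k, by omega⟩))
          (p.fst (σ₁ ⟨2 * k + 1, by omega⟩))) *
        (∏ k : Fin (L / 2), Γ.edgeDodgson (p.snd (σ₂ ⟨2 * k, by omega⟩))
          (p.snd (σ₂ ⟨2 * k + 1, by omega⟩)))) := by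
      rw [termWeight, Fintype.prod_sum_type, Fintype.prod_sum_type]
      rfl
    rw [hw]
    push_cast
    ring
  have h2 : Γ.Q L E = ∑ x : Halving L E × Equiv.Perm (Fin L) × Equiv.Perm (Fin L),
      ∑ ρ : Equiv.Perm (Fin L), ((Equiv.Perm.sign ρ : ℤ) : MvPolynomial (Fin m) ℝ) *
        ((pairSign (spell x).1 : MvPolynomial (Fin m) ℝ) * Γ.termWeight ρ (spell x).1) := by
    rw [Q, Fintype.sum_prod_type]
    refine Finset.sum_congr rfl fun p _ => ?_
    rw [Fintype.sum_prod_type, pairingSum, pairingSum, mul_assoc, Finset.sum_mul_sum, Finset.mul_sum]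
    refine Finset.sum_congr rfl fun σ₁ _ => ?_
    rw [Finset.mul_sum]
    refine Finset.sum_congr rfl fun σ₂ _ => ?_
    rw [← h1 p σ₁ σ₂]
    simp only [mul_assoc]
  -- With ρ outside, halvings and rearrangements together run over all spellings exactly once.
  rw [h2, Finset.sum_comm]
  refine Finset.sum_eq_zero fun ρ _ => ?_
  rw [← Finset.mul_sum, spell_bijective.sum_comp fun g : Spelling L E =>
    (pairSign g.1 : MvPolynomial (Fin m) ℝ) * Γ.termWeight ρ g.1,
    Γ.sum_spelling_eq_zero hL h0, mul_zero]

end FeynmanGraph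

end

theorem mainTheorem1 {n m : ℕ} (Γ : FeynmanGraph n m) :
    (Γ.IsOnePI → ∀ L : ℕ, Γ.loopNumber = L → Even L → 0 < L →
      ∀ E : Finset (Fin m), E.card = 2 * L →
        Γ.Q L E = 0 ∧ ∀ a : Fin m → ℝ, (∀ e, 0 < a e) → Γ.barQ E a = 0) ∧
    (∀ a : Fin m → ℝ, (∀ e, 0 < a e) →
      ∀ S : Finset (Fin m), MeasureTheory.Integrable (Γ.fiberCoeff a S)) ∧
    (¬ Γ.IsTree → ∀ a : Fin m → ℝ, (∀ e, 0 < a e) → Γ.alpha a * Γ.alpha a = 0) := by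
  refine ⟨fun _ L hL hLe hL0 E _ => ⟨Γ.Q_eq_zero hLe hL0, fun a ha => ?_⟩,
    fun a ha S => Γ.integrable_fiberCoeff ha S, fun h a ha => Γ.alpha_mul_self_eq_zero h ha⟩
  have hT : ¬ Γ.IsTree := fun h => by
    have h' := h.2
    rw [hL] at h'
    omega
  rw [FeynmanGraph.barQ, Γ.alpha_mul_self_eq_zero hT ha, map_zero, Finsupp.zero_apply]
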